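/- Let $\Omega$ be the set of pairs $\omega=(\alpha,\gamma)$, where $\gamma\ge 0$ and $\alpha=(\alpha_j)_{j\ge1}$ is a summable sequence of nonnegative reals, two such pairs being identified when they have the same $\gamma$ and their sequences differ by a permutation. Equip $\Omega$ with the initial topology associated with the functions $$L_f(\omega)=\gamma f(0)+\sum_{j=1}^\infty\alpha_j f(\alpha_j),\qquad f:\mathbb R\to\mathbb R \text{ continuous},$$ and, for $\omega\in\Omega$ and $t\in\mathbb R$, put $$\Pi(\omega,t)=e^{-\frac14\gamma t^2}\prod_{j=1}^\infty\frac1{1+\frac14\alpha_j t^2}.$$ For $\lambda=(\lambda_1,\dots,\lambda_n)\in\mathbb R^n$ let $T_n(\lambda)\in\Omega$ be the point with $\gamma=0$, $\alpha_j=(\lambda_j/n)^2$ for $1\le j\le n$ and $\alpha_j=0$ for $j>n$. For an infinite complex matrix $\xi$ with finitely many nonzero entries put $$\varphi_n(\xi,\lambda)=\int_{U(n)}\int_{U(n)}e^{i\,\mathrm{Re}\,\mathrm{tr}\left(\xi_n\,(u\,\mathrm{diag}(\lambda_1,\dots,\lambda_n)\,v^*)^*\right)}\,\alpha_n(du)\,\alpha_n(dv),$$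 where $\xi_n$ is the upper left $n\times n$ corner of $\xi$ and $\alpha_n$ is the normalized Haar measure of the unitary group $U(n)$. **Theorem.** Let $\lambda^{(n)}\in\mathbb R^n$ $(n\ge1)$ be such that $T_n(\lambda^{(n)})\to\omega$ in $\Omega$ as $n\to\infty$, for some $\omega\in\Omega$. Then, for every $k$, $$\lim_{n\to\infty}\varphi_n\big(\mathrm{diag}(\xi_1,\dots,\xi_k,0,\dots),\lambda^{(n)}\big)=\prod_{j=1}^k\Pi(\omega,\xi_j),$$ uniformly for $(\xi_1,\dots,\xi_k)$ in compact subsets of $\mathbb R^k$. -/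

import Mathlib

open MeasureTheory Filter Topology

noncomputable section

/-- A representative of a point of the parameter space `Ω`: a summable sequence of nonnegative
reals `α` together with a nonnegative real `γ`. -/
structure PolyaParam where
  α : ℕ → ℝ
  γ : ℝ
  α_nonneg : ∀ j, 0 ≤ α j
  α_summable : Summable α
  γ_nonneg : 0 ≤ γ

/-- Two parameters are identified when they differ by a permutation of the `α j`. -/
instance polyaSetoid : Setoid PolyaParam where
  r a b := a.γ = b.γ ∧ ∃ e : Equiv.Perm ℕ, ∀ j, a.α (e j) = b.α j
  iseqv :=
    { refl := fun _ => ⟨rfl, Equiv.refl ℕ, fun _ => rfl⟩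
      symm := fun {a b} h => by
        obtain ⟨h1, e, he⟩ := h
        exact ⟨h1.symm, e.symm, fun j => by rw [← he, Equiv.apply_symm_apply]⟩
      trans := fun {a b c} h h' => by
        obtain ⟨h1, e, he⟩ := h
        obtain ⟨h2, e', he'⟩ := h'
        exact ⟨h1.trans h2, e'.trans e, fun j => by
          rw [Equiv.trans_apply, he, he']⟩ }

/-- The parameter space `Ω` of point configurations `ω = (α, γ)`: the sequence `α` is taken up
to permutation. -/
def PolyaSpace : Type := Quotient polyaSetoid

/-- `L_f(ω) = γ f(0) + ∑_j α_j f(α_j)`, the integral of `f` against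
`σ_ω = γ δ_0 + ∑_j α_j δ_{α_j}`. -/
def polyaL (f : C(ℝ, ℝ)) : PolyaSpace → ℝ :=
  Quotient.lift (fun a : PolyaParam => a.γ * f 0 + ∑' j, a.α j * f (a.α j)) (by
    rintro a b ⟨h1, e, he⟩
    have h := Equiv.tsum_eq e (fun j => a.α j * f (a.α j))
    simp only [he] at h
    simp only [h1, h])

/-- The initial topology on `Ω` associated with the functions `L_f`, `f` continuous on `ℝ`. -/
instance polyaTopology : TopologicalSpace PolyaSpace :=
  ⨅ f : C(ℝ, ℝ), TopologicalSpace.induced (polyaL f) inferInstance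

/-- The modified Pólya function
`Π(ω, t) = exp (-γ t² / 4) ∏_j 1 / (1 + α_j t² / 4)`. -/
def modifiedPolya (ω : PolyaSpace) (t : ℝ) : ℝ :=
  Quotient.lift (fun a : PolyaParam =>
    Real.exp (-(1 / 4) * a.γ * t ^ 2) * ∏' j, 1 / (1 + 1 / 4 * a.α j * t ^ 2)) (by
    rintro a b ⟨h1, e, he⟩
    have h := Equiv.tprod_eq e (fun j => 1 / (1 + 1 / 4 * a.α j * t ^ 2))
    simp only [he] at h
    simp only [h1, h]) ω

/-- The point of `Ω` with `γ = 0` and `α_j = (l_j / n)²` for the `n` coordinates `l_j` of `l`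
(and `α_j = 0` at the remaining indices). -/
def polyaT (n : ℕ) (l : Fin n → ℝ) : PolyaSpace :=
  Quotient.mk polyaSetoid
    { α := fun j => if h : j < n then (l ⟨j, h⟩ / n) ^ 2 else 0
      γ := 0
      α_nonneg := fun j => by
        split_ifs
        · positivity
        · exact le_rfl
      α_summable := summable_of_ne_finset_zero (s := Finset.range n) (fun j hj => by
        rw [Finset.mem_range] at hj
        rw [dif_neg hj])
      γ_nonneg := le_rfl }

/-- The unitary group `U(n)` with its Borel `σ`-algebra. -/
instance unitaryMeasurableSpace (n : ℕ) :
    MeasurableSpace (Matrix.unitaryGroup (Fin n) ℂ) := borel _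

instance unitaryBorelSpace (n : ℕ) : BorelSpace (Matrix.unitaryGroup (Fin n) ℂ) := ⟨rfl⟩

instance unitaryCompactSpace (n : ℕ) : CompactSpace (Matrix.unitaryGroup (Fin n) ℂ) := by
  have hK : IsCompact (Set.univ.pi fun _ : Fin n => Set.univ.pi fun _ : Fin n =>
      Metric.closedBall (0 : ℂ) 1) :=
    isCompact_univ_pi fun _ => isCompact_univ_pi fun _ => isCompact_closedBall _ _
  have hcl : IsClosed {A : Matrix (Fin n) (Fin n) ℂ | A * star A = 1} :=
    isClosed_eq (by fun_prop) continuous_const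
  rw [← isCompact_univ_iff, Subtype.isCompact_iff, Set.image_univ, Subtype.range_coe_subtype]
  have : {A : Matrix (Fin n) (Fin n) ℂ | A ∈ Matrix.unitaryGroup (Fin n) ℂ}
      = {A | A * star A = 1} := by
    ext A
    exact Matrix.mem_unitaryGroup_iff
  rw [this]
  refine IsCompact.of_isClosed_subset hK hcl ?_
  intro A hA i _ j _
  rw [mem_closedBall_zero_iff]
  exact entry_norm_bound_of_unitary (Matrix.mem_unitaryGroup_iff.mpr hA) i j

/-- The normalized Haar measure of `U(n)`. -/
def unitaryHaar (n : ℕ) : Measure (Matrix.unitaryGroup (Fin n) ℂ) :=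
  Measure.haarMeasure ⊤

/-- The infinite matrix `diag(ξ_1, …, ξ_k, 0, …)`. -/
def infDiag {k : ℕ} (ξ : Fin k → ℝ) : Matrix ℕ ℕ ℂ :=
  Matrix.diagonal fun i => if h : i < k then ((ξ ⟨i, h⟩ : ℝ) : ℂ) else 0

/-- The upper left `n × n` corner of an infinite matrix. The pairing of an infinite matrix with an
`n × n` matrix (extended by zeros) only involves this corner. -/
def corner (n : ℕ) (x : Matrix ℕ ℕ ℂ) : Matrix (Fin n) (Fin n) ℂ :=
  x.submatrix (fun i => (i : ℕ)) (fun i => (i : ℕ))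

/-- The spherical function `φ_n(x, l)`: the Fourier transform, at the infinite matrix `x`, of the
orbital measure of `diag(l_1, …, l_n)`, that is
`∫_{U(n) × U(n)} exp (i ⟨x, u diag(l) v*⟩) du dv` with `⟨x, y⟩ = Re tr (x y*)`. -/
def sphericalFn (n : ℕ) (x : Matrix ℕ ℕ ℂ) (l : Fin n → ℝ) : ℂ :=
  ∫ u : Matrix.unitaryGroup (Fin n) ℂ, ∫ v : Matrix.unitaryGroup (Fin n) ℂ,
    Complex.exp (Complex.I * ((Matrix.trace (corner n x *
      ((u : Matrix (Fin n) (Fin n) ℂ) * Matrix.diagonal (fun i => ((l i : ℝ) : ℂ)) *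
        star (v : Matrix (Fin n) (Fin n) ℂ)).conjTranspose)).re : ℂ))
    ∂unitaryHaar n ∂unitaryHaar n

end

/-! For a diagonal argument with `k` entries only the first `k` rows of `u` and `v` enter the
spherical function: it is the Haar average of exp(i Re tr(η Yᴴ diag(l) X)), where the `n × k`
matrices `X`, `Y` carry those rows as columns. For large `n` they behave like independent complex
Gaussian matrices divided by √(2n), and for these the average is exactly ∏ Π(T_n(l), ξ_j) at every
finite `n` (`gaussianPhase_diagonal`).

The replacement is made quantitative by polar decomposition. A scaled Gaussian matrix is `W_k S`,
with `W_k` formed by `k` columns of a unitary matrix and `S` the square root of the Gram matrix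
(`Matrix.exists_polar`). Gaussian matrices are unitarily invariant, so a Haar rotation can be
inserted for free; it absorbs `W_k` and leaves the Haar average at the perturbed parameter `S η Tᴴ`
(`integral_rotatedPhase_eq`). The Gram matrix is an average of `n` independent terms, so `S` and `T`
are within O(1/√n) of the identity in mean (`exists_integral_gramDefect_sq_le`). The Haar average is
Lipschitz in its parameter, with a constant controlled by ∑ (l_i/n)², the total mass of the measure
attached to T_n(l) (`norm_unitaryPhase_sub_le`). Convergence in Ω bounds this mass, so the error
tends to zero.

It remains to let T_n(l) tend to ω inside Π. Since Π(ω,t) = exp(-L_f(ω)) for the continuous function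
f(x) = log(1+t²x/4)/x, this is continuity for the topology of Ω, made joint in `t` by a Lipschitz
estimate (`continuous_modifiedPolya`). -/

/-! ### Joint continuity of the modified Pólya function -/

/-- The function `y ↦ log (1 + y) / y` on `[0, ∞)`, extended continuously to the real line. -/
noncomputable def logQuot (y : ℝ) : ℝ := dslope Real.log 1 (1 + max y 0)

/-- Clipping by `max y 0` keeps the argument at least 1, away from the singularity of the logarithm;
at 1 itself the difference quotient extends by the derivative. -/
lemma continuous_logQuot : Continuous logQuot := by
  rw [continuous_iff_continuousAt]
  intro y
  have h : ContinuousAt (dslope Real.log 1) (1 + max y 0) := by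
    by_cases h1 : 1 + max y 0 = 1
    · rw [h1, continuousAt_dslope_same]
      exact Real.differentiableAt_log one_ne_zero
    · rw [continuousAt_dslope_of_ne h1]
      exact Real.continuousAt_log (by positivity)
  exact ContinuousAt.comp (g := dslope Real.log 1) (f := fun y : ℝ => 1 + max y 0) h
    (by fun_prop)

lemma mul_logQuot {y : ℝ} (hy : 0 ≤ y) : y * logQuot y = Real.log (1 + y) := by
  rw [logQuot, max_eq_left hy]
  have := sub_smul_dslope Real.log 1 (1 + y)
  simpa using this

lemma logQuot_zero : logQuot 0 = 1 := by
  simp [logQuot]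

/-- The test function `x ↦ log (1 + q x) / x`, `q = t² / 4`, for which
`modifiedPolya ω t = exp (- polyaL (polyaTest t) ω)`. -/
noncomputable def polyaTest (t : ℝ) : C(ℝ, ℝ) where
  toFun x := t ^ 2 / 4 * logQuot (t ^ 2 / 4 * x)
  continuous_toFun := by
    have := continuous_logQuot
    fun_prop

lemma polyaTest_zero (t : ℝ) : polyaTest t 0 = t ^ 2 / 4 := by
  simp [polyaTest, logQuot_zero]

lemma mul_polyaTest (t : ℝ) {x : ℝ} (hx : 0 ≤ x) :
    x * polyaTest t x = Real.log (1 + t ^ 2 / 4 * x) := by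
  rw [← mul_logQuot (by positivity)]
  simp only [polyaTest, ContinuousMap.coe_mk]
  ring

/-- The logarithm of the ratio is at most the ratio minus one, and the denominator `1 + q * x` is at
least 1. -/
lemma log_one_add_mul_sub_le {x p q : ℝ} (hx : 0 ≤ x) (hp : 0 ≤ p) (hq : 0 ≤ q) :
    Real.log (1 + p * x) - Real.log (1 + q * x) ≤ |p - q| * x := by
  have hp' : 0 < 1 + p * x := by positivity
  have hq' : 0 < 1 + q * x := by positivity
  rw [← Real.log_div hp'.ne' hq'.ne']
  refine (Real.log_le_sub_one_of_pos (by positivity)).trans ?_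
  rw [div_sub_one hq'.ne', div_le_iff₀ hq']
  have h1 : (1 + p * x - (1 + q * x)) ≤ |p - q| * x := by
    have := mul_le_mul_of_nonneg_right (le_abs_self (p - q)) hx
    linarith
  refine h1.trans ?_
  have h2 : 0 ≤ |p - q| * x := by positivity
  have h3 : 0 ≤ q * x := by positivity
  nlinarith

lemma abs_log_one_add_mul_sub_le {x p q : ℝ} (hx : 0 ≤ x) (hp : 0 ≤ p) (hq : 0 ≤ q) :
    |Real.log (1 + p * x) - Real.log (1 + q * x)| ≤ |p - q| * x := by
  rw [abs_sub_le_iff]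
  refine ⟨log_one_add_mul_sub_le hx hp hq, ?_⟩
  rw [abs_sub_comm]
  exact log_one_add_mul_sub_le hx hq hp

lemma summable_mul_polyaTest (a : PolyaParam) (t : ℝ) :
    Summable fun j => a.α j * polyaTest t (a.α j) := by
  refine (a.α_summable.mul_left (t ^ 2 / 4)).of_norm_bounded fun j => ?_
  rw [mul_polyaTest t (a.α_nonneg j), Real.norm_eq_abs]
  have := abs_log_one_add_mul_sub_le (a.α_nonneg j) (p := t ^ 2 / 4) (q := 0)
    (by positivity) le_rfl
  simpa [abs_of_nonneg (show 0 ≤ t ^ 2 / 4 by positivity)] using this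

/-- The factor with γ is the contribution of the atom at 0, where the test function equals t²/4;
summability of the logarithms turns the product into the exponential of a sum. -/
lemma modifiedPolya_eq_exp (ω : PolyaSpace) (t : ℝ) :
    modifiedPolya ω t = Real.exp (-polyaL (polyaTest t) ω) := by
  induction ω using Quotient.inductionOn with
  | h a =>
    change Real.exp (-(1 / 4) * a.γ * t ^ 2) * ∏' j, 1 / (1 + 1 / 4 * a.α j * t ^ 2) =
      Real.exp (-(a.γ * polyaTest t 0 + ∑' j, a.α j * polyaTest t (a.α j)))
    have hs := (summable_mul_polyaTest a t).neg
    rw [neg_add, Real.exp_add, ← tsum_neg, ← (hs.hasSum.rexp).tprod_eq, polyaTest_zero]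
    congr 1
    · congr 1; ring
    · congr 1; ext j
      have : (0 : ℝ) < 1 + t ^ 2 / 4 * a.α j := by
        have := a.α_nonneg j
        positivity
      rw [Function.comp_apply, mul_polyaTest t (a.α_nonneg j), Real.exp_neg, Real.exp_log this,
        one_div]
      congr 1; ring

lemma abs_polyaL_polyaTest_sub_le (ω : PolyaSpace) (s t : ℝ) :
    |polyaL (polyaTest s) ω - polyaL (polyaTest t) ω| ≤
      |s ^ 2 / 4 - t ^ 2 / 4| * polyaL (ContinuousMap.const ℝ 1) ω := by
  induction ω using Quotient.inductionOn with
  | h a =>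
    change |(a.γ * polyaTest s 0 + ∑' j, a.α j * polyaTest s (a.α j)) -
      (a.γ * polyaTest t 0 + ∑' j, a.α j * polyaTest t (a.α j))| ≤
      _ * (a.γ * 1 + ∑' j, a.α j * 1)
    simp only [mul_one, polyaTest_zero]
    have h1 := summable_mul_polyaTest a s
    have h2 := summable_mul_polyaTest a t
    rw [add_sub_add_comm, ← h1.tsum_sub h2, mul_add, ← mul_sub, ← tsum_mul_left]
    refine (abs_add_le _ _).trans (add_le_add ?_ ?_)
    · rw [abs_mul, abs_of_nonneg a.γ_nonneg, mul_comm]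
    · rw [← Real.norm_eq_abs]
      refine tsum_of_norm_bounded (a.α_summable.mul_left _).hasSum fun j => ?_
      rw [Real.norm_eq_abs, mul_polyaTest _ (a.α_nonneg j), mul_polyaTest _ (a.α_nonneg j)]
      exact abs_log_one_add_mul_sub_le (a.α_nonneg j) (by positivity) (by positivity)

lemma continuous_polyaL (f : C(ℝ, ℝ)) : Continuous (polyaL f) :=
  continuous_iInf_dom (i := f) continuous_induced_dom

/-- The topology of Ω gives continuity in ω only for fixed `t`. The change in `t` is at most |s²/4 -
t²/4| times the total mass `L_1`, which is itself continuous and hence locally bounded. -/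
lemma continuous_modifiedPolya :
    Continuous fun p : PolyaSpace × ℝ => modifiedPolya p.1 p.2 := by
  simp only [modifiedPolya_eq_exp]
  refine Real.continuous_exp.comp (Continuous.neg ?_)
  rw [continuous_iff_continuousAt]
  rintro ⟨ω, t⟩
  have h1 : Tendsto (fun p : PolyaSpace × ℝ => polyaL (polyaTest t) p.1) (𝓝 (ω, t))
      (𝓝 (polyaL (polyaTest t) ω)) :=
    ((continuous_polyaL _).comp continuous_fst).tendsto _
  have h2 : Tendsto (fun p : PolyaSpace × ℝ =>
      polyaL (polyaTest p.2) p.1 - polyaL (polyaTest t) p.1) (𝓝 (ω, t)) (𝓝 0) := by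
    refine squeeze_zero_norm (fun p => abs_polyaL_polyaTest_sub_le p.1 p.2 t) ?_
    have h3 : Continuous fun p : PolyaSpace × ℝ =>
        |p.2 ^ 2 / 4 - t ^ 2 / 4| * polyaL (ContinuousMap.const ℝ 1) p.1 := by
      have := continuous_polyaL (ContinuousMap.const ℝ 1)
      fun_prop
    simpa using h3.tendsto (ω, t)
  simpa [ContinuousAt] using h2.add h1

lemma modifiedPolya_polyaT (n : ℕ) (l : Fin n → ℝ) (t : ℝ) :
    modifiedPolya (polyaT n l) t = ∏ i, 1 / (1 + (t * (l i / n)) ^ 2 / 4) := by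
  change Real.exp (-(1 / 4) * 0 * t ^ 2) * ∏' j : ℕ, 1 / (1 + 1 / 4 *
    (if h : j < n then (l ⟨j, h⟩ / n) ^ 2 else 0) * t ^ 2) = _
  rw [tprod_eq_prod (s := Finset.range n), Finset.prod_range]
  · simp only [mul_zero, zero_mul, Real.exp_zero, one_mul, Fin.is_lt, dite_true, Fin.eta]
    refine Finset.prod_congr rfl fun i _ => ?_
    congr 2; ring
  · intro j hj
    rw [Finset.mem_range] at hj
    simp [hj]

lemma polyaL_one_polyaT (n : ℕ) (l : Fin n → ℝ) :
    polyaL (ContinuousMap.const ℝ 1) (polyaT n l) = ∑ i, (l i / n) ^ 2 := by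
  change 0 * (1 : ℝ) + ∑' j : ℕ, (if h : j < n then (l ⟨j, h⟩ / n) ^ 2 else 0) * (1 : ℝ) = _
  rw [tsum_eq_sum (s := Finset.range n), Finset.sum_range]
  · simp
  · intro j hj
    rw [Finset.mem_range] at hj
    simp [hj]

/-! ### Frobenius norm, unitary completion and polar decomposition -/

section

open scoped MatrixOrder ComplexOrder Matrix.Norms.Frobenius Matrix

lemma Matrix.frobenius_norm_sq {m n : Type*} [Fintype m] [Fintype n] (A : Matrix m n ℂ) :
    ‖A‖ ^ 2 = ∑ i, ∑ j, ‖A i j‖ ^ 2 := by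
  rw [Matrix.frobenius_norm_def, ← Real.sqrt_eq_rpow, Real.sq_sqrt]
  · simp
  · positivity

lemma Matrix.frobenius_norm_sq_eq_trace {m n : Type*} [Fintype m] [Fintype n]
    (A : Matrix m n ℂ) : ‖A‖ ^ 2 = (A * Aᴴ).trace.re := by
  rw [Matrix.frobenius_norm_sq]
  simp [Matrix.trace, Matrix.mul_apply, Complex.mul_conj, Complex.normSq_eq_norm_sq,
    -Complex.ofReal_pow]

lemma Matrix.norm_trace_mul_le {m n : Type*} [Fintype m] [Fintype n]
    (A : Matrix m n ℂ) (B : Matrix n m ℂ) : ‖(A * B).trace‖ ≤ ‖A‖ * ‖B‖ := by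
  have h1 : ‖(A * B).trace‖ ≤ ∑ p : m × n, ‖A p.1 p.2‖ * ‖B p.2 p.1‖ := by
    rw [Fintype.sum_prod_type]
    simp only [Matrix.trace, Matrix.diag, Matrix.mul_apply]
    refine norm_sum_le_of_le _ fun i _ => norm_sum_le_of_le _ fun j _ => ?_
    rw [norm_mul]
  refine h1.trans ?_
  have h2 := Finset.sum_mul_sq_le_sq_mul_sq Finset.univ (fun p : m × n => ‖A p.1 p.2‖)
    (fun p : m × n => ‖B p.2 p.1‖)
  rw [Fintype.sum_prod_type (fun p : m × n => ‖A p.1 p.2‖ ^ 2),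
    Fintype.sum_prod_type_right (fun p : m × n => ‖B p.2 p.1‖ ^ 2)] at h2
  dsimp only at h2
  rw [← Matrix.frobenius_norm_sq, ← Matrix.frobenius_norm_sq, ← mul_pow] at h2
  exact abs_le_of_sq_le_sq' h2 (by positivity) |>.2

/-- With D = S - 1 one has S² - 1 = D + DS. Expanding the squared norm, the cross terms are traces
of the positive semidefinite matrix D S Dᴴ, so they only increase it beyond ‖D‖². -/
lemma Matrix.PosSemidef.norm_sub_one_le {n : Type*} [Fintype n] [DecidableEq n]
    {S : Matrix n n ℂ} (hS : S.PosSemidef) : ‖S - 1‖ ≤ ‖S * S - 1‖ := by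
  set D := S - 1 with hD
  have h0 : S * S - 1 = D + D * S := by rw [hD]; noncomm_ring
  have h1 : (D + D * S) * (D + D * S)ᴴ
      = D * Dᴴ + D * S * Dᴴ + (D * S * Dᴴ) + (D * S) * (D * S)ᴴ := by
    rw [Matrix.conjTranspose_add, Matrix.conjTranspose_mul, hS.isHermitian.eq]
    noncomm_ring
  have h2 : 0 ≤ (D * S * Dᴴ).trace.re :=
    (Complex.le_def.mp (hS.mul_mul_conjTranspose_same D).trace_nonneg).1
  have h3 : ‖D‖ ^ 2 ≤ ‖S * S - 1‖ ^ 2 := by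
    rw [h0, Matrix.frobenius_norm_sq_eq_trace (D + D * S), h1]
    simp only [Matrix.trace_add, Complex.add_re, ← Matrix.frobenius_norm_sq_eq_trace]
    linarith [sq_nonneg ‖D * S‖]
  exact (sq_le_sq₀ (norm_nonneg _) (norm_nonneg _)).mp h3

/-- A matrix with orthonormal columns is a submatrix of a unitary matrix. -/
lemma Matrix.exists_unitary_submatrix_eq {ι κ : Type*} [Fintype ι] [DecidableEq ι] [Fintype κ]
    [DecidableEq κ] (e : κ ↪ ι) (Q : Matrix ι κ ℂ) (hQ : Qᴴ * Q = 1) :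
    ∃ W ∈ Matrix.unitaryGroup ι ℂ, W.submatrix id e = Q := by
  -- The value 0 off the range of `e` is immaterial: the extended orthonormal basis has to agree
  -- with `v` on that range only.
  let v : ι → EuclideanSpace ℂ ι :=
    Function.extend e (fun j => WithLp.toLp 2 fun i => Q i j) 0
  have hv (j : κ) : v (e j) = WithLp.toLp 2 fun i => Q i j := e.injective.extend_apply _ _ j
  have hinner (a b : κ) : inner ℂ (v (e a)) (v (e b)) = if a = b then (1 : ℂ) else 0 := by
    rw [hv, hv, ← Matrix.one_apply, ← hQ]
    simp [PiLp.inner_apply, Matrix.mul_apply, mul_comm]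
  have horth : Orthonormal ℂ ((Set.range e).domRestrict v) := by
    rw [orthonormal_iff_ite]
    rintro ⟨_, a, rfl⟩ ⟨_, b, rfl⟩
    refine (hinner a b).trans ?_
    by_cases h : a = b
    · subst h
      simp
    · rw [if_neg h, if_neg fun h' => h (e.injective (congrArg Subtype.val h'))]
  obtain ⟨b, hb⟩ := horth.exists_orthonormalBasis_extension_of_card_eq (by simp)
  refine ⟨Matrix.of fun i j => b j i, ?_, ?_⟩
  · rw [Matrix.mem_unitaryGroup_iff']
    ext i j
    have := orthonormal_iff_ite.mp b.orthonormal i j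
    rw [PiLp.inner_apply] at this
    simpa [Matrix.mul_apply, Matrix.one_apply, mul_comm, Matrix.star_eq_conjTranspose] using this
  · ext i j
    simp [hb _ (Set.mem_range_self j), hv]

/-- Polar decomposition of a tall matrix whose columns are almost orthonormal. -/
lemma Matrix.exists_polar {ι κ : Type*} [Fintype ι] [DecidableEq ι] [Fintype κ]
    [DecidableEq κ] (e : κ ↪ ι) (G : Matrix ι κ ℂ) (hG : ‖Gᴴ * G - 1‖ < 1) :
    ∃ S : Matrix κ κ ℂ, Sᴴ = S ∧ ‖S - 1‖ ≤ ‖Gᴴ * G - 1‖ ∧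
      ∃ W ∈ Matrix.unitaryGroup ι ℂ, G = W.submatrix id e * S := by
  have hA : (Gᴴ * G).PosSemidef := Matrix.posSemidef_conjTranspose_mul_self G
  set S := CFC.sqrt (Gᴴ * G) with hSdef
  have hS : S.PosSemidef := Matrix.nonneg_iff_posSemidef.mp (CFC.sqrt_nonneg _)
  have hSS : S * S = Gᴴ * G := CFC.sqrt_mul_sqrt_self _ hA.nonneg
  have hle : ‖S - 1‖ ≤ ‖Gᴴ * G - 1‖ := hSS ▸ hS.norm_sub_one_le
  -- ‖S - 1‖ < 1 makes `S` invertible by the Neumann series, so `G * S⁻¹` has exactly orthonormal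
  -- columns and can be completed to a unitary matrix.
  have hunit : IsUnit S := by
    have h := isUnit_one_sub_of_norm_lt_one (x := 1 - S)
      (by rw [norm_sub_rev]; exact hle.trans_lt hG)
    simpa using h
  have hdet : IsUnit S.det := (Matrix.isUnit_iff_isUnit_det S).mp hunit
  have hQ : (G * S⁻¹)ᴴ * (G * S⁻¹) = 1 := by
    rw [Matrix.conjTranspose_mul, Matrix.conjTranspose_nonsing_inv, hS.isHermitian.eq,
      Matrix.mul_assoc, ← Matrix.mul_assoc Gᴴ, ← hSS, Matrix.mul_assoc S,
      Matrix.mul_nonsing_inv _ hdet, Matrix.mul_one, Matrix.nonsing_inv_mul _ hdet]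
  obtain ⟨W, hW, hWQ⟩ := Matrix.exists_unitary_submatrix_eq e (G * S⁻¹) hQ
  refine ⟨S, hS.isHermitian.eq, hle, W, hW, ?_⟩
  rw [hWQ, Matrix.mul_assoc, Matrix.nonsing_inv_mul _ hdet, Matrix.mul_one]

lemma Matrix.norm_mul_mul_sub_le {κ : Type*} [Fintype κ] [DecidableEq κ]
    (S T η : Matrix κ κ ℂ) {a b : ℝ} (ha : ‖S - 1‖ ≤ a) (hb : ‖T - 1‖ ≤ b) :
    ‖S * η * T - η‖ ≤ ‖η‖ * (a * b + a + b) := by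
  have ha0 : 0 ≤ a := (norm_nonneg _).trans ha
  have h : S * η * T - η = (S - 1) * η * (T - 1) + (S - 1) * η + η * (T - 1) := by
    noncomm_ring
  rw [h]
  have h1 : ‖(S - 1) * η‖ ≤ a * ‖η‖ :=
    (norm_mul_le _ _).trans (by gcongr)
  have h2 : ‖(S - 1) * η * (T - 1)‖ ≤ a * ‖η‖ * b :=
    (norm_mul_le _ _).trans (by gcongr)
  have h3 : ‖η * (T - 1)‖ ≤ ‖η‖ * b :=
    (norm_mul_le _ _).trans (by gcongr)
  refine (norm_add₃_le).trans ?_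
  linarith

end

/-! ### Second moments of Haar unitary matrices -/

section Haar

open scoped Matrix

variable {n : ℕ}

instance isProbabilityMeasure_unitaryHaar (n : ℕ) : IsProbabilityMeasure (unitaryHaar n) :=
  ⟨by simpa [unitaryHaar] using Measure.haarMeasure_self (K₀ := (⊤ : TopologicalSpace.PositiveCompacts
    (Matrix.unitaryGroup (Fin n) ℂ)))⟩

instance isHaarMeasure_unitaryHaar (n : ℕ) : (unitaryHaar n).IsHaarMeasure := by
  unfold unitaryHaar
  infer_instance

/-- A right translate of Haar measure is again a Haar probability measure, hence the same one by
uniqueness. -/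
instance isMulRightInvariant_unitaryHaar (n : ℕ) : (unitaryHaar n).IsMulRightInvariant := by
  refine ⟨fun g => ?_⟩
  have : IsProbabilityMeasure ((unitaryHaar n).map (· * g)) :=
    Measure.isProbabilityMeasure_map (by fun_prop)
  exact Measure.isHaarMeasure_eq_of_isProbabilityMeasure _ _

instance secondCountableTopology_unitaryGroup (n : ℕ) :
    SecondCountableTopology (Matrix.unitaryGroup (Fin n) ℂ) := by
  have : SecondCountableTopology (Matrix (Fin n) (Fin n) ℂ) :=
    inferInstanceAs (SecondCountableTopology (Fin n → Fin n → ℂ))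
  exact TopologicalSpace.Subtype.secondCountableTopology _

lemma continuous_unitary_apply (i j : Fin n) :
    Continuous fun u : Matrix.unitaryGroup (Fin n) ℂ => (u : Matrix (Fin n) (Fin n) ℂ) i j :=
  continuous_subtype_val.matrix_elem i j

lemma integrable_unitaryHaar {E : Type*} [NormedAddCommGroup E]
    {f : Matrix.unitaryGroup (Fin n) ℂ → E} (hf : Continuous f) :
    Integrable f (unitaryHaar n) :=
  hf.integrable_of_hasCompactSupport (HasCompactSupport.of_compactSpace f)

lemma integral_unitary_mul_conj_of_ne (a : Fin n) {l m : Fin n} (h : l ≠ m) :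
    ∫ u : Matrix.unitaryGroup (Fin n) ℂ, (u : Matrix (Fin n) (Fin n) ℂ) a l *
      starRingEnd ℂ ((u : Matrix (Fin n) (Fin n) ℂ) a m) ∂unitaryHaar n = 0 := by
  -- Right translation by this matrix changes the sign of column `m` alone, so the integral equals
  -- its own negative.
  let d : Fin n → ℂ := fun i => if i = m then -1 else 1
  have hd : Matrix.diagonal d ∈ Matrix.unitaryGroup (Fin n) ℂ := by
    rw [Matrix.mem_unitaryGroup_iff, Matrix.star_eq_conjTranspose, Matrix.diagonal_conjTranspose,
      Matrix.diagonal_mul_diagonal, ← Matrix.diagonal_one]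
    congr 1
    ext i
    by_cases hi : i = m <;> simp [d, hi]
  have key := integral_mul_right_eq_self (μ := unitaryHaar n)
    (fun u : Matrix.unitaryGroup (Fin n) ℂ => (u : Matrix (Fin n) (Fin n) ℂ) a l *
      starRingEnd ℂ ((u : Matrix (Fin n) (Fin n) ℂ) a m)) ⟨_, hd⟩
  simp only [Submonoid.coe_mul, Matrix.mul_diagonal, d, if_neg h, if_true, mul_one,
    map_neg, mul_neg, integral_neg] at key
  exact self_eq_neg.mp key.symm

lemma integral_norm_sq_unitary_eq (a l m : Fin n) :
    ∫ u : Matrix.unitaryGroup (Fin n) ℂ, ‖(u : Matrix (Fin n) (Fin n) ℂ) a l‖ ^ 2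
        ∂unitaryHaar n =
      ∫ u : Matrix.unitaryGroup (Fin n) ℂ, ‖(u : Matrix (Fin n) (Fin n) ℂ) a m‖ ^ 2
        ∂unitaryHaar n := by
  have hd : (1 : Matrix (Fin n) (Fin n) ℂ).submatrix id (Equiv.swap l m) ∈
      Matrix.unitaryGroup (Fin n) ℂ := by
    rw [Matrix.mem_unitaryGroup_iff, Matrix.star_eq_conjTranspose, Matrix.conjTranspose_submatrix,
      Matrix.submatrix_mul_equiv]
    simp
  have key := integral_mul_right_eq_self (μ := unitaryHaar n)
    (fun u : Matrix.unitaryGroup (Fin n) ℂ => ‖(u : Matrix (Fin n) (Fin n) ℂ) a l‖ ^ 2) ⟨_, hd⟩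
  rw [← key]
  refine integral_congr_ae (.of_forall fun u => ?_)
  simp [Matrix.mul_apply, Matrix.one_apply]

/-- The `n` entries of a row have equal second moments, by column permutations, and their squared
moduli add up to 1. -/
lemma integral_norm_sq_unitary (a l : Fin n) :
    ∫ u : Matrix.unitaryGroup (Fin n) ℂ, ‖(u : Matrix (Fin n) (Fin n) ℂ) a l‖ ^ 2
        ∂unitaryHaar n = 1 / n := by
  have hrow (u : Matrix.unitaryGroup (Fin n) ℂ) :
      ∑ m, ‖(u : Matrix (Fin n) (Fin n) ℂ) a m‖ ^ 2 = 1 := by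
    have h := congrFun (congrFun (Matrix.mem_unitaryGroup_iff.mp u.2) a) a
    rw [Matrix.mul_apply, Matrix.one_apply_eq] at h
    have h2 := congrArg Complex.re h
    simpa [Complex.mul_conj, Complex.normSq_eq_norm_sq, -Complex.ofReal_pow,
      Matrix.star_apply] using h2
  have hsum := integral_finsetSum (μ := unitaryHaar n) Finset.univ
    (f := fun m (u : Matrix.unitaryGroup (Fin n) ℂ) => ‖(u : Matrix (Fin n) (Fin n) ℂ) a m‖ ^ 2)
    (fun m _ => integrable_unitaryHaar ((continuous_unitary_apply a m).norm.pow 2))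
  simp only [hrow, integral_const, probReal_univ, smul_eq_mul, mul_one,
    integral_norm_sq_unitary_eq a _ l, Finset.sum_const, Finset.card_univ, Fintype.card_fin,
    nsmul_eq_mul] at hsum
  have hn : (n : ℝ) ≠ 0 := by
    have := a.pos
    positivity
  field_simp
  linarith

lemma integral_norm_sq_sum_unitary (a : Fin n) (w : Fin n → ℂ) :
    ∫ u : Matrix.unitaryGroup (Fin n) ℂ, ‖∑ l, w l * (u : Matrix (Fin n) (Fin n) ℂ) a l‖ ^ 2
        ∂unitaryHaar n = (∑ l, ‖w l‖ ^ 2) / n := by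
  have hexp (u : Matrix.unitaryGroup (Fin n) ℂ) :
      ((‖∑ l, w l * (u : Matrix (Fin n) (Fin n) ℂ) a l‖ ^ 2 : ℝ) : ℂ) =
        ∑ l, ∑ m, w l * starRingEnd ℂ (w m) * ((u : Matrix (Fin n) (Fin n) ℂ) a l *
          starRingEnd ℂ ((u : Matrix (Fin n) (Fin n) ℂ) a m)) := by
    rw [← Complex.normSq_eq_norm_sq, ← Complex.mul_conj, map_sum, Finset.sum_mul_sum]
    refine Finset.sum_congr rfl fun l _ => Finset.sum_congr rfl fun m _ => ?_
    rw [map_mul]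
    ring
  have hint (l m : Fin n) : Integrable (fun u : Matrix.unitaryGroup (Fin n) ℂ =>
      w l * starRingEnd ℂ (w m) * ((u : Matrix (Fin n) (Fin n) ℂ) a l *
          starRingEnd ℂ ((u : Matrix (Fin n) (Fin n) ℂ) a m))) (unitaryHaar n) := by
    have h1 := continuous_unitary_apply a l
    have h2 := continuous_unitary_apply a m
    exact integrable_unitaryHaar (continuous_const.mul
      (h1.mul (Complex.continuous_conj.comp h2)))
  have hdiag (l : Fin n) : ∫ u : Matrix.unitaryGroup (Fin n) ℂ,
      (u : Matrix (Fin n) (Fin n) ℂ) a l *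
          starRingEnd ℂ ((u : Matrix (Fin n) (Fin n) ℂ) a l) ∂unitaryHaar n = 1 / n := by
    simp_rw [Complex.mul_conj, Complex.normSq_eq_norm_sq]
    rw [integral_complex_ofReal, integral_norm_sq_unitary]
    simp
  apply Complex.ofReal_injective
  rw [← integral_complex_ofReal]
  simp_rw [hexp]
  rw [integral_finsetSum _ fun l _ => integrable_finsetSum _ fun m _ => hint l m]
  simp_rw [integral_finsetSum _ fun m _ => hint _ m, integral_const_mul]
  rw [Complex.ofReal_div, Complex.ofReal_sum, Finset.sum_div]
  refine Finset.sum_congr rfl fun l _ => ?_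
  rw [Finset.sum_eq_single l, hdiag, Complex.mul_conj, Complex.normSq_eq_norm_sq]
  · simp [div_eq_mul_inv]
  · intro m _ hm
    rw [integral_unitary_mul_conj_of_ne a hm.symm, mul_zero]
  · simp

end Haar

/-! ### The spherical function as a phase average, and its Lipschitz dependence on the parameter -/

section Bessel

open scoped Matrix

variable {n k : ℕ}

lemma Complex.norm_exp_I_mul_sub_exp_I_mul_le (a b : ℝ) :
    ‖Complex.exp (Complex.I * a) - Complex.exp (Complex.I * b)‖ ≤ |a - b| := by
  have h : Complex.exp (Complex.I * a) - Complex.exp (Complex.I * b) =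
      Complex.exp (Complex.I * b) * (Complex.exp (Complex.I * (a - b : ℝ)) - 1) := by
    rw [mul_sub, ← Complex.exp_add, mul_one]
    congr 2
    push_cast
    ring
  rw [h, norm_mul, mul_comm Complex.I (b : ℂ), Complex.norm_exp_ofReal_mul_I, one_mul]
  exact Real.norm_exp_I_mul_ofReal_sub_one_le

/-- The first `k` rows of an `n × n` matrix, as the columns of an `n × k` matrix. -/
def topRows (h : k ≤ n) (U : Matrix (Fin n) (Fin n) ℂ) : Matrix (Fin n) (Fin k) ℂ :=
  Uᵀ.submatrix id (Fin.castLE h)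

/-- The sesquilinear matrix `Yᴴ diag(l) X`. -/
def weightedGram (l : Fin n → ℝ) (X Y : Matrix (Fin n) (Fin k) ℂ) : Matrix (Fin k) (Fin k) ℂ :=
  Yᴴ * Matrix.diagonal (fun i => (l i : ℂ)) * X

lemma weightedGram_apply (l : Fin n → ℝ) (X Y : Matrix (Fin n) (Fin k) ℂ) (j i : Fin k) :
    weightedGram l X Y j i = ∑ m, starRingEnd ℂ (Y m j) * l m * X m i := by
  rw [weightedGram, Matrix.mul_apply]
  simp [Matrix.mul_diagonal]

lemma trace_mul_weightedGram_mul (l : Fin n → ℝ) (X Y : Matrix (Fin n) (Fin k) ℂ)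
    (η S T : Matrix (Fin k) (Fin k) ℂ) :
    (η * weightedGram l (X * S) (Y * T)).trace = (S * η * Tᴴ * weightedGram l X Y).trace := by
  have h : weightedGram l (X * S) (Y * T) = Tᴴ * weightedGram l X Y * S := by
    simp only [weightedGram, Matrix.conjTranspose_mul, Matrix.mul_assoc]
  rw [h, ← Matrix.mul_assoc, Matrix.trace_mul_comm]
  simp only [Matrix.mul_assoc]

/-- The phase `exp (i Re tr (η Yᴴ diag(l) X))`. -/
noncomputable def phase (l : Fin n → ℝ) (η : Matrix (Fin k) (Fin k) ℂ)
    (X Y : Matrix (Fin n) (Fin k) ℂ) : ℂ :=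
  Complex.exp (Complex.I * ((η * weightedGram l X Y).trace.re : ℂ))

lemma norm_phase (l : Fin n → ℝ) (η : Matrix (Fin k) (Fin k) ℂ)
    (X Y : Matrix (Fin n) (Fin k) ℂ) : ‖phase l η X Y‖ = 1 :=
  Complex.norm_exp_I_mul_ofReal _

lemma continuous_weightedGram (l : Fin n → ℝ) {T : Type*} [TopologicalSpace T]
    {X Y : T → Matrix (Fin n) (Fin k) ℂ} (hX : Continuous X) (hY : Continuous Y) :
    Continuous fun t => weightedGram l (X t) (Y t) :=
  (hY.matrix_conjTranspose.matrix_mul continuous_const).matrix_mul hX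

lemma continuous_phase (l : Fin n → ℝ) (η : Matrix (Fin k) (Fin k) ℂ) {T : Type*}
    [TopologicalSpace T] {X Y : T → Matrix (Fin n) (Fin k) ℂ} (hX : Continuous X)
    (hY : Continuous Y) : Continuous fun t => phase l η (X t) (Y t) := by
  have h : Continuous fun t => (η * weightedGram l (X t) (Y t)).trace :=
    (continuous_const.matrix_mul (continuous_weightedGram l hX hY)).matrix_trace
  unfold phase
  fun_prop

lemma continuous_topRows (h : k ≤ n) :
    Continuous fun u : Matrix.unitaryGroup (Fin n) ℂ => topRows h (u : Matrix _ _ ℂ) :=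
  (continuous_subtype_val.matrix_transpose).matrix_submatrix _ _

/-- The average of `phase` over pairs of independent Haar distributed unitary matrices. -/
noncomputable def unitaryPhase (h : k ≤ n) (l : Fin n → ℝ) (η : Matrix (Fin k) (Fin k) ℂ) : ℂ :=
  ∫ p : Matrix.unitaryGroup (Fin n) ℂ × Matrix.unitaryGroup (Fin n) ℂ,
    phase l η (topRows h p.1) (topRows h p.2) ∂((unitaryHaar n).prod (unitaryHaar n))

lemma integrable_unitaryHaar_prod {E : Type*} [NormedAddCommGroup E]
    {f : Matrix.unitaryGroup (Fin n) ℂ × Matrix.unitaryGroup (Fin n) ℂ → E}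
    (hf : Continuous f) : Integrable f ((unitaryHaar n).prod (unitaryHaar n)) :=
  hf.integrable_of_hasCompactSupport (HasCompactSupport.of_compactSpace f)

lemma continuous_phase_topRows (h : k ≤ n) (l : Fin n → ℝ) (η : Matrix (Fin k) (Fin k) ℂ) :
    Continuous fun p : Matrix.unitaryGroup (Fin n) ℂ × Matrix.unitaryGroup (Fin n) ℂ =>
      phase l η (topRows h p.1) (topRows h p.2) :=
  continuous_phase l η ((continuous_topRows h).comp continuous_fst)
    ((continuous_topRows h).comp continuous_snd)

lemma sphericalFn_infDiag (h : k ≤ n) (l : Fin n → ℝ) (ξ : Fin k → ℝ) :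
    sphericalFn n (infDiag ξ) l =
      unitaryPhase h l (Matrix.diagonal fun j => (ξ j : ℂ)) := by
  rw [unitaryPhase, integral_prod _ (integrable_unitaryHaar_prod (continuous_phase_topRows h l _)),
    sphericalFn]
  refine integral_congr_ae (.of_forall fun u => integral_congr_ae (.of_forall fun v => ?_))
  have hcorner : corner n (infDiag ξ) =
      Matrix.diagonal fun i : Fin n => if hi : (i : ℕ) < k then ((ξ ⟨i, hi⟩ : ℝ) : ℂ) else 0 := by
    ext i j
    simp [corner, infDiag, Matrix.diagonal_apply, Fin.ext_iff]
  dsimp only [phase]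
  congr 3
  rw [hcorner]
  simp only [Matrix.trace, Matrix.diag, Matrix.diagonal_mul, weightedGram_apply]
  rw [Complex.re_sum, Complex.re_sum]
  have hsub := Finset.sum_subset (Finset.subset_univ (Finset.univ.map (Fin.castLEEmb h)))
    (f := fun i : Fin n => ((if hi : (i : ℕ) < k then ((ξ ⟨i, hi⟩ : ℝ) : ℂ) else 0) *
      ((u : Matrix (Fin n) (Fin n) ℂ) * Matrix.diagonal (fun i => ((l i : ℝ) : ℂ)) *
        star (v : Matrix (Fin n) (Fin n) ℂ)).conjTranspose i i).re) (by
    intro i _ hi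
    have : ¬ (i : ℕ) < k := fun hik => hi (by
      simp only [Finset.mem_map, Finset.mem_univ, true_and]
      exact ⟨⟨i, hik⟩, by ext; simp⟩)
    simp [this])
  rw [← hsub, Finset.sum_map]
  refine Finset.sum_congr rfl fun j _ => ?_
  simp only [Fin.castLEEmb_apply, Fin.val_castLE, Fin.is_lt, dite_true, Fin.eta,
    Complex.re_ofReal_mul]
  congr 1
  -- The adjoint conjugates the diagonal entry, which does not affect its real part.
  rw [Matrix.conjTranspose_apply, Matrix.mul_apply, ← Complex.conj_re]
  simp only [Matrix.mul_diagonal, RCLike.star_def, starRingEnd_self_apply, Matrix.star_apply]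
  congr 1
  refine Finset.sum_congr rfl fun m _ => ?_
  simp only [topRows, Matrix.submatrix_apply, Matrix.transpose_apply, id]
  ring

open scoped Matrix.Norms.Frobenius in
lemma integral_norm_sq_weightedGram (h : k ≤ n) (l : Fin n → ℝ) :
    ∫ p : Matrix.unitaryGroup (Fin n) ℂ × Matrix.unitaryGroup (Fin n) ℂ,
      ‖weightedGram l (topRows h p.1) (topRows h p.2)‖ ^ 2
        ∂((unitaryHaar n).prod (unitaryHaar n)) = k ^ 2 * ∑ i, (l i / n) ^ 2 := by
  have hc (i j : Fin k) : Continuous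
      fun p : Matrix.unitaryGroup (Fin n) ℂ × Matrix.unitaryGroup (Fin n) ℂ =>
        ‖weightedGram l (topRows h p.1) (topRows h p.2) i j‖ ^ 2 :=
    (((continuous_weightedGram l ((continuous_topRows h).comp continuous_fst)
      ((continuous_topRows h).comp continuous_snd)).matrix_elem i j).norm.pow 2)
  have hentry (i j : Fin k) :
      ∫ p : Matrix.unitaryGroup (Fin n) ℂ × Matrix.unitaryGroup (Fin n) ℂ,
        ‖weightedGram l (topRows h p.1) (topRows h p.2) i j‖ ^ 2
          ∂((unitaryHaar n).prod (unitaryHaar n)) = ∑ i, (l i / n) ^ 2 := by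
    -- Integrating over `u` with `v` fixed treats the entry as a linear form in a row of `u`, giving
    -- ∑ l_m² |v_jm|² / n; the integral over `v` supplies the second factor 1/n.
    rw [integral_prod_symm _ (integrable_unitaryHaar_prod (hc i j))]
    simp only [weightedGram_apply, topRows, Matrix.submatrix_apply, Matrix.transpose_apply, id,
      integral_norm_sq_sum_unitary, norm_mul, RCLike.norm_conj, mul_pow, integral_div]
    rw [integral_finsetSum]
    · simp only [integral_mul_const, integral_norm_sq_unitary]
      rw [Finset.sum_div]
      refine Finset.sum_congr rfl fun m _ => ?_
      rw [Complex.norm_real, Real.norm_eq_abs, sq_abs]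
      ring
    · intro m _
      exact integrable_unitaryHaar (((continuous_unitary_apply _ _).norm.pow 2).mul
        continuous_const)
  simp only [Matrix.frobenius_norm_sq]
  rw [integral_finsetSum _ fun i _ => integrable_finsetSum _ fun j _ =>
    integrable_unitaryHaar_prod (hc i j)]
  simp only [integral_finsetSum _ fun j _ => integrable_unitaryHaar_prod (hc _ j), hentry,
    Finset.sum_const, Finset.card_univ, Fintype.card_fin, nsmul_eq_mul]
  ring

open scoped Matrix.Norms.Frobenius in
-- The phase is 1-Lipschitz in its real exponent, and Cauchy–Schwarz bounds the change of exponent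
-- by ‖η - θ‖ ‖Z‖, `Z` being the weighted Gram matrix. Using ‖Z‖ ≤ 1 + ‖Z‖² reduces everything to
-- the second moment.
lemma norm_unitaryPhase_sub_le (h : k ≤ n) (l : Fin n → ℝ) (η θ : Matrix (Fin k) (Fin k) ℂ) :
    ‖unitaryPhase h l η - unitaryPhase h l θ‖ ≤
      ‖η - θ‖ * (1 + k ^ 2 * ∑ i, (l i / n) ^ 2) := by
  have hZ := continuous_weightedGram l
    ((continuous_topRows h).comp (continuous_fst (Y := Matrix.unitaryGroup (Fin n) ℂ)))
    ((continuous_topRows h).comp (continuous_snd (X := Matrix.unitaryGroup (Fin n) ℂ)))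
  have hZ2 : Integrable (fun p : Matrix.unitaryGroup (Fin n) ℂ × Matrix.unitaryGroup (Fin n) ℂ =>
      ‖weightedGram l (topRows h p.1) (topRows h p.2)‖ ^ 2)
      ((unitaryHaar n).prod (unitaryHaar n)) := by
    simp only [Matrix.frobenius_norm_sq]
    exact integrable_finsetSum _ fun i _ => integrable_finsetSum _ fun j _ =>
      integrable_unitaryHaar_prod ((hZ.matrix_elem i j).norm.pow 2)
  rw [unitaryPhase, unitaryPhase, ← integral_sub
    (integrable_unitaryHaar_prod (continuous_phase_topRows h l _))
    (integrable_unitaryHaar_prod (continuous_phase_topRows h l _)),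
    ← integral_norm_sq_weightedGram h l]
  have hone : (1 : ℝ) = ∫ _ : Matrix.unitaryGroup (Fin n) ℂ × Matrix.unitaryGroup (Fin n) ℂ,
      (1 : ℝ) ∂((unitaryHaar n).prod (unitaryHaar n)) := by simp
  rw [hone, ← integral_add (integrable_const _) hZ2, ← integral_const_mul]
  refine norm_integral_le_of_norm_le (((integrable_const _).add hZ2).const_mul _)
    (.of_forall fun p => ?_)
  refine (Complex.norm_exp_I_mul_sub_exp_I_mul_le _ _).trans ?_
  rw [← Complex.sub_re, ← Matrix.trace_sub, ← Matrix.sub_mul]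
  refine (Complex.abs_re_le_norm _).trans ((Matrix.norm_trace_mul_le _ _).trans ?_)
  gcongr
  nlinarith [sq_nonneg (‖weightedGram l (topRows h p.1) (topRows h p.2)‖ - 1)]

lemma norm_unitaryPhase_le (h : k ≤ n) (l : Fin n → ℝ) (η : Matrix (Fin k) (Fin k) ℂ) :
    ‖unitaryPhase h l η‖ ≤ 1 := by
  refine (norm_integral_le_of_norm_le (integrable_const 1)
    (.of_forall fun p => (norm_phase _ _ _ _).le)).trans ?_
  simp

end Bessel

/-! ### Gaussian matrices: unitary invariance and an exact integral -/

section GaussianMatrix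

open scoped Matrix Matrix.Norms.Frobenius
open ProbabilityTheory

/-- The law of an `n × k` matrix with independent standard complex Gaussian entries, whose real
and imaginary parts have variance `1`. -/
noncomputable def gaussianMatrix (n k : ℕ) : Measure (Fin n → Fin k → ℂ) :=
  Measure.pi fun _ => Measure.pi fun _ => stdGaussian ℂ

instance isProbabilityMeasure_gaussianMatrix (n k : ℕ) :
    IsProbabilityMeasure (gaussianMatrix n k) := by
  unfold gaussianMatrix
  infer_instance

lemma charFunDual_stdGaussian_complex (L : StrongDual ℝ ℂ) :
    charFunDual (stdGaussian ℂ) L = Complex.exp (-(L 1 ^ 2 + L Complex.I ^ 2 : ℝ) / 2) := by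
  rw [charFunDual_stdGaussian, ← Complex.ofReal_pow, Complex.orthonormalBasisOneI.norm_dual]
  simp

variable {n k : ℕ}

/-- The matrix of complex coefficients of a real linear functional on complex matrices. -/
noncomputable def dualCoeff (L : StrongDual ℝ (Fin n → Fin k → ℂ)) : Matrix (Fin n) (Fin k) ℂ :=
  Matrix.of fun i j => ⟨L (Pi.single i (Pi.single j 1)), -L (Pi.single i (Pi.single j Complex.I))⟩

lemma charFunDual_gaussianMatrix (L : StrongDual ℝ (Fin n → Fin k → ℂ)) :
    charFunDual (gaussianMatrix n k) L =
      Complex.exp (-(‖dualCoeff L‖ ^ 2 : ℝ) / 2) := by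
  rw [gaussianMatrix, charFunDual_pi]
  simp only [charFunDual_pi, charFunDual_stdGaussian_complex, ← Complex.exp_sum]
  congr 1
  rw [Matrix.frobenius_norm_sq]
  simp only [Complex.sq_norm, Complex.normSq_apply, dualCoeff, Matrix.of_apply]
  push_cast
  simp only [← Finset.sum_div, Finset.sum_neg_distrib]
  congr 2
  refine Finset.sum_congr rfl fun i _ => Finset.sum_congr rfl fun j _ => ?_
  simp
  ring

/-- The minus sign in the imaginary part of `dualCoeff` is what makes `L` the real part of a complex
bilinear pairing. -/
lemma dual_apply_eq_re_sum (L : StrongDual ℝ (Fin n → Fin k → ℂ)) (G : Fin n → Fin k → ℂ) :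
    L G = (∑ i, ∑ j, dualCoeff L i j * G i j).re := by
  let E (i : Fin n) (j : Fin k) (z : ℂ) : Fin n → Fin k → ℂ := Pi.single i (Pi.single j z)
  have hG : G = ∑ i, ∑ j, ((G i j).re • E i j 1 + (G i j).im • E i j Complex.I) := by
    ext a b
    simp only [E, Finset.sum_apply, Pi.add_apply, Pi.smul_apply]
    rw [Finset.sum_eq_single a, Finset.sum_eq_single b]
    · simp
    · intro c _ hc
      simp [hc.symm]
    · simp
    · intro c _ hc
      simp [hc.symm]
    · simp
  conv_lhs => rw [hG]
  simp only [E, map_sum, map_add, map_smul, smul_eq_mul, Complex.re_sum, Complex.mul_re, dualCoeff,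
    Matrix.of_apply]
  refine Finset.sum_congr rfl fun i _ => Finset.sum_congr rfl fun j _ => ?_
  ring

/-- Left multiplication by a square matrix, as a real linear map. -/
noncomputable def leftMulCLM (k : ℕ) (U : Matrix (Fin n) (Fin n) ℂ) :
    (Fin n → Fin k → ℂ) →L[ℝ] (Fin n → Fin k → ℂ) :=
  LinearMap.toContinuousLinearMap
    { toFun := fun G => (U * Matrix.of G : Matrix (Fin n) (Fin k) ℂ)
      map_add' := fun _ _ => Matrix.mul_add U _ _
      map_smul' := fun c _ => Matrix.mul_smul U c _ }

lemma leftMulCLM_apply (U : Matrix (Fin n) (Fin n) ℂ) (G : Fin n → Fin k → ℂ) :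
    leftMulCLM k U G = U * Matrix.of G := rfl

lemma dualCoeff_comp_leftMulCLM (L : StrongDual ℝ (Fin n → Fin k → ℂ))
    (U : Matrix (Fin n) (Fin n) ℂ) :
    dualCoeff (L.comp (leftMulCLM k U)) = Uᵀ * dualCoeff L := by
  ext i j
  have h (z : ℂ) : L (leftMulCLM k U (Pi.single i (Pi.single j z))) =
      (z * (Uᵀ * dualCoeff L) i j).re := by
    rw [dual_apply_eq_re_sum, Matrix.mul_apply, Finset.mul_sum]
    congr 1
    refine Finset.sum_congr rfl fun a _ => ?_
    rw [Finset.sum_eq_single j]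
    · rw [leftMulCLM_apply, Matrix.mul_apply, Finset.sum_eq_single i]
      · simp
        ring
      · intro c _ hc
        simp [hc]
      · simp
    · intro c _ hc
      rw [leftMulCLM_apply, Matrix.mul_apply]
      refine mul_eq_zero_of_right _ (Finset.sum_eq_zero fun m _ => ?_)
      simp [Pi.single_apply, hc, ite_apply]
    · simp
  apply Complex.ext
  · simp [dualCoeff, h]
  · simp [dualCoeff, h]

lemma frobenius_norm_unitary_mul {U : Matrix (Fin n) (Fin n) ℂ}
    (hU : U ∈ Matrix.unitaryGroup (Fin n) ℂ) (A : Matrix (Fin n) (Fin k) ℂ) :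
    ‖U * A‖ = ‖A‖ := by
  rw [← sq_eq_sq₀ (norm_nonneg _) (norm_nonneg _), Matrix.frobenius_norm_sq_eq_trace,
    Matrix.frobenius_norm_sq_eq_trace, Matrix.conjTranspose_mul, Matrix.mul_assoc,
    Matrix.trace_mul_comm, ← Matrix.mul_assoc A, Matrix.mul_assoc _ Uᴴ,
    ← Matrix.star_eq_conjTranspose U, Matrix.mem_unitaryGroup_iff'.mp hU, Matrix.mul_one]

/-- Complex Gaussian matrices are invariant in law under the unitary group. -/
lemma measurePreserving_leftMulCLM {U : Matrix (Fin n) (Fin n) ℂ}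
    (hU : U ∈ Matrix.unitaryGroup (Fin n) ℂ) :
    MeasurePreserving (leftMulCLM k U) (gaussianMatrix n k) (gaussianMatrix n k) := by
  refine ⟨(leftMulCLM k U).continuous.measurable, ?_⟩
  have : IsProbabilityMeasure ((gaussianMatrix n k).map (leftMulCLM k U)) :=
    Measure.isProbabilityMeasure_map (leftMulCLM k U).continuous.measurable.aemeasurable
  -- The characteristic function sees `L` only through ‖`dualCoeff L`‖, and composing with `U`
  -- multiplies the coefficients by the unitary matrix `Uᵀ`.
  apply Measure.ext_of_charFunDual
  ext L
  rw [charFunDual_map, charFunDual_gaussianMatrix, charFunDual_gaussianMatrix,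
    dualCoeff_comp_leftMulCLM,
    frobenius_norm_unitary_mul (Matrix.transpose_mem_unitaryGroup_iff.mpr hU)]

/-- The real and imaginary parts each contribute (1 + c²)^(-1/2); their product has no square root.
-/
lemma integral_exp_neg_mul_norm_sq_stdGaussian (c : ℝ) :
    ∫ z : ℂ, Complex.exp (-(c ^ 2 * ‖z‖ ^ 2 : ℝ) / 2) ∂stdGaussian ℂ =
      ((1 / (1 + c ^ 2) : ℝ) : ℂ) := by
  rw [stdGaussian_eq_map_pi_orthonormalBasis Complex.orthonormalBasisOneI,
    integral_map (Measurable.aemeasurable (by fun_prop))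
      (Continuous.aestronglyMeasurable (by fun_prop))]
  have h (x : Fin 2 → ℝ) :
      Complex.exp (-(c ^ 2 * ‖∑ i, x i • Complex.orthonormalBasisOneI i‖ ^ 2 : ℝ) / 2) =
        ∏ i, ((Real.exp (-(c ^ 2 * x i ^ 2) / 2) : ℝ) : ℂ) := by
    rw [Complex.sq_norm, Fin.sum_univ_two, Fin.prod_univ_two, ← Complex.ofReal_mul,
      ← Real.exp_add, Complex.ofReal_exp]
    congr 1
    simp [Complex.normSq_apply]
    ring
  have hg : ∫ x : ℝ, Real.exp (-(c ^ 2 * x ^ 2) / 2) ∂gaussianReal 0 1 =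
      √(1 / (1 + c ^ 2)) := by
    rw [integral_gaussianReal_eq_integral_smul one_ne_zero]
    simp only [gaussianPDFReal, smul_eq_mul, sub_zero, NNReal.coe_one, mul_one]
    have h2 (x : ℝ) : (√(2 * Real.pi))⁻¹ * Real.exp (-x ^ 2 / 2) *
        Real.exp (-(c ^ 2 * x ^ 2) / 2) =
          (√(2 * Real.pi))⁻¹ * Real.exp (-((1 + c ^ 2) / 2) * x ^ 2) := by
      rw [mul_assoc, ← Real.exp_add]
      congr 2
      ring
    simp only [h2, integral_const_mul, integral_gaussian]
    rw [← Real.sqrt_inv, ← Real.sqrt_mul (by positivity)]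
    congr 1
    have := Real.pi_pos
    field_simp
  simp_rw [h]
  rw [integral_fintype_prod_eq_prod (f := fun _ x => ((Real.exp (-(c ^ 2 * x ^ 2) / 2) : ℝ) : ℂ))]
  simp only [integral_complex_ofReal, hg, Fin.prod_univ_two]
  rw [← Complex.ofReal_mul, Real.mul_self_sqrt (by positivity)]

lemma integral_exp_re_mul_conj_stdGaussian (c : ℝ) (g : ℂ) :
    ∫ z : ℂ, Complex.exp (Complex.I * ((c * (g * starRingEnd ℂ z).re : ℝ) : ℂ)) ∂stdGaussian ℂ =
      Complex.exp (-(c ^ 2 * ‖g‖ ^ 2 : ℝ) / 2) := by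
  have h := charFun_stdGaussian (c • g)
  rw [charFun_apply] at h
  convert h using 3 with z
  · rw [mul_comm]
    congr 2
    simp only [Complex.inner, Complex.real_smul, Complex.mul_re, Complex.conj_re,
      Complex.conj_im, Complex.ofReal_re, Complex.ofReal_im, Complex.mul_im]
    ring_nf
  · rw [← Complex.ofReal_pow, norm_smul, mul_pow, Real.norm_eq_abs, sq_abs]

/-- Integrating out the second matrix gives its characteristic function at the first; the remaining
Gaussian integrals factor over the entries. -/
lemma integral_exp_gaussianMatrix_prod (c : Fin n → Fin k → ℝ) :
    ∫ p, Complex.exp (Complex.I *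
        ((∑ i, ∑ j, c i j * (p.1 i j * starRingEnd ℂ (p.2 i j)).re : ℝ) : ℂ))
      ∂((gaussianMatrix n k).prod (gaussianMatrix n k)) =
        ((∏ i, ∏ j, 1 / (1 + c i j ^ 2) : ℝ) : ℂ) := by
  have hcont : Continuous fun p : (Fin n → Fin k → ℂ) × (Fin n → Fin k → ℂ) =>
      Complex.exp (Complex.I *
        ((∑ i, ∑ j, c i j * (p.1 i j * starRingEnd ℂ (p.2 i j)).re : ℝ) : ℂ)) := by
    simp only [Complex.mul_re, Complex.conj_re, Complex.conj_im]
    fun_prop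
  have hint : Integrable (fun p : (Fin n → Fin k → ℂ) × (Fin n → Fin k → ℂ) =>
      Complex.exp (Complex.I *
        ((∑ i, ∑ j, c i j * (p.1 i j * starRingEnd ℂ (p.2 i j)).re : ℝ) : ℂ)))
      ((gaussianMatrix n k).prod (gaussianMatrix n k)) :=
    Integrable.of_bound hcont.aestronglyMeasurable 1
      (.of_forall fun p => (Complex.norm_exp_I_mul_ofReal _).le)
  rw [integral_prod _ hint]
  have h1 (G : Fin n → Fin k → ℂ) : ∫ H, Complex.exp (Complex.I *
        ((∑ i, ∑ j, c i j * (G i j * starRingEnd ℂ (H i j)).re : ℝ) : ℂ)) ∂gaussianMatrix n k =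
      ∏ i, ∏ j, Complex.exp (-(c i j ^ 2 * ‖G i j‖ ^ 2 : ℝ) / 2) := by
    simp only [Complex.ofReal_sum, Finset.mul_sum, Complex.exp_sum]
    rw [gaussianMatrix, integral_fintype_prod_eq_prod (f := fun i (H : Fin k → ℂ) =>
      ∏ j, Complex.exp (Complex.I * ((c i j * (G i j * starRingEnd ℂ (H j)).re : ℝ) : ℂ)))]
    refine Finset.prod_congr rfl fun i _ => ?_
    rw [integral_fintype_prod_eq_prod (f := fun j (z : ℂ) =>
      Complex.exp (Complex.I * ((c i j * (G i j * starRingEnd ℂ z).re : ℝ) : ℂ)))]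
    exact Finset.prod_congr rfl fun j _ => integral_exp_re_mul_conj_stdGaussian _ _
  simp only [h1]
  rw [gaussianMatrix, integral_fintype_prod_eq_prod (f := fun i (G : Fin k → ℂ) =>
      ∏ j, Complex.exp (-(c i j ^ 2 * ‖G j‖ ^ 2 : ℝ) / 2)), Complex.ofReal_prod]
  refine Finset.prod_congr rfl fun i _ => ?_
  rw [integral_fintype_prod_eq_prod (f := fun j (z : ℂ) =>
      Complex.exp (-(c i j ^ 2 * ‖z‖ ^ 2 : ℝ) / 2)), Complex.ofReal_prod]
  exact Finset.prod_congr rfl fun j _ => integral_exp_neg_mul_norm_sq_stdGaussian _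

end GaussianMatrix

/-! ### Concentration of the Gram matrix of a Gaussian matrix -/

section GramConcentration

open scoped Matrix Matrix.Norms.Frobenius
open ProbabilityTheory

/-- Variances of independent variables add, so the mean of `n` copies has variance Var/n. -/
lemma integral_sq_average_sub {Ω : Type*} [MeasurableSpace Ω] {ν : Measure Ω}
    [IsProbabilityMeasure ν] {X : Ω → ℝ} (hX : MemLp X 2 ν) {n : ℕ} (hn : n ≠ 0) :
    ∫ G : Fin n → Ω, ((∑ l, X (G l)) / n - ∫ g, X g ∂ν) ^ 2 ∂Measure.pi (fun _ => ν) =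
      Var[X; ν] / n := by
  have hn' : (n : ℝ) ≠ 0 := by positivity
  have hmem (l : Fin n) : MemLp (fun G : Fin n → Ω => X (G l)) 2 (Measure.pi fun _ => ν) :=
    hX.comp_measurePreserving (measurePreserving_eval _ l)
  have hmean (l : Fin n) : ∫ G : Fin n → Ω, X (G l) ∂Measure.pi (fun _ => ν) = ∫ g, X g ∂ν := by
    have := integral_map (μ := Measure.pi fun _ : Fin n => ν) (φ := Function.eval l) (f := X)
      (measurable_pi_apply l).aemeasurable
      (by rw [(measurePreserving_eval _ l).map_eq]; exact hX.aestronglyMeasurable)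
    rw [(measurePreserving_eval _ l).map_eq] at this
    exact this.symm
  have hvar := variance_sum_pi (μ := fun _ : Fin n => ν) (X := fun _ => X) fun _ => hX
  have hsum : MemLp (∑ l, fun G : Fin n → Ω => X (G l)) 2 (Measure.pi fun _ => ν) :=
    memLp_finsetSum' _ fun l _ => hmem l
  rw [variance_eq_integral hsum.aestronglyMeasurable.aemeasurable] at hvar
  simp only [Finset.sum_apply] at hvar
  rw [integral_finsetSum _ fun l _ => (hmem l).integrable one_le_two] at hvar
  simp only [hmean, Finset.sum_const, Finset.card_univ, Fintype.card_fin, nsmul_eq_mul] at hvar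
  have h (G : Fin n → Ω) : ((∑ l, X (G l)) / n - ∫ g, X g ∂ν) ^ 2 =
      (∑ l, X (G l) - n * ∫ g, X g ∂ν) ^ 2 * (1 / (n : ℝ) ^ 2) := by
    field_simp
  simp_rw [h]
  rw [integral_mul_const, hvar]
  field_simp

variable {k : ℕ}

/-- The law of a vector of independent standard complex Gaussian variables. -/
noncomputable abbrev gaussianVector (k : ℕ) : Measure (Fin k → ℂ) :=
  Measure.pi fun _ => stdGaussian ℂ

lemma integral_norm_sq_stdGaussian_complex :
    Integrable (fun z : ℂ => starRingEnd ℂ z * z) (stdGaussian ℂ) ∧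
      ∫ z : ℂ, starRingEnd ℂ z * z ∂stdGaussian ℂ = 2 := by
  have h (L : StrongDual ℝ ℂ) : ∫ z, L z ^ 2 ∂stdGaussian ℂ = ‖L‖ ^ 2 := by
    rw [← variance_dual_stdGaussian, variance_of_integral_eq_zero L.continuous.aemeasurable
      (integral_strongDual_stdGaussian L)]
  have hi (L : StrongDual ℝ ℂ) : Integrable (fun z => L z ^ 2) (stdGaussian ℂ) :=
    (L.comp_memLp' IsGaussian.memLp_two_id).integrable_sq
  have h1 := h Complex.reCLM
  have h2 := h Complex.imCLM
  have heq (z : ℂ) : starRingEnd ℂ z * z = ((Complex.reCLM z ^ 2 + Complex.imCLM z ^ 2 : ℝ) : ℂ) := by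
    rw [mul_comm, Complex.mul_conj, Complex.normSq_apply]
    simp [sq]
  simp_rw [heq]
  refine ⟨((hi _).add (hi _)).ofReal, ?_⟩
  rw [integral_complex_ofReal, integral_add (hi _) (hi _), h1, h2]
  norm_num

lemma integral_conj_mul_gaussianVector (i j : Fin k) :
    ∫ g, starRingEnd ℂ (g i) * g j ∂gaussianVector k = if i = j then 2 else 0 := by
  have heval (f : ℂ → ℂ) (hf : Continuous f) (a : Fin k) :
      ∫ g, f (g a) ∂gaussianVector k = ∫ z, f z ∂stdGaussian ℂ := by
    rw [← (measurePreserving_eval (fun _ : Fin k => stdGaussian ℂ) a).map_eq,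
      integral_map (measurable_pi_apply a).aemeasurable hf.aestronglyMeasurable]
  split_ifs with h
  · subst h
    rw [heval (fun z => starRingEnd ℂ z * z) (Complex.continuous_conj.mul continuous_id) i]
    exact integral_norm_sq_stdGaussian_complex.2
  · have hind : IndepFun (fun g : Fin k → ℂ => starRingEnd ℂ (g i)) (fun g : Fin k → ℂ => g j)
        (gaussianVector k) :=
      ((iIndepFun_pi (μ := fun _ : Fin k => stdGaussian ℂ) (X := fun _ z => z)
        fun _ => aemeasurable_id).indepFun h).comp Complex.continuous_conj.measurable measurable_id
    have := hind.integral_fun_mul_eq_mul_integral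
      (Complex.continuous_conj.comp (continuous_apply i)).aestronglyMeasurable
      (continuous_apply j).aestronglyMeasurable
    rw [this, heval (fun z => z) continuous_id j, integral_id_stdGaussian, mul_zero]

/-- Square integrability of the product follows from finite fourth moments and |ab|² ≤ |a|⁴ + |b|⁴.
-/
lemma memLp_conj_mul_gaussianVector (i j : Fin k) :
    MemLp (fun g => starRingEnd ℂ (g i) * g j) 2 (gaussianVector k) := by
  have hcont : Continuous fun g : Fin k → ℂ => starRingEnd ℂ (g i) * g j :=
    (Complex.continuous_conj.comp (continuous_apply i)).mul (continuous_apply j)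
  rw [memLp_two_iff_integrable_sq_norm hcont.aestronglyMeasurable]
  have h4 (a : Fin k) : Integrable (fun g => ‖g a‖ ^ 4) (gaussianVector k) := by
    have h := (IsGaussian.memLp_id (stdGaussian ℂ) 4 (by norm_num)).integrable_norm_pow
      (p := 4) (by norm_num)
    exact (measurePreserving_eval (fun _ : Fin k => stdGaussian ℂ) a).integrable_comp_of_integrable
      h
  refine ((h4 i).add (h4 j)).mono' (hcont.norm.pow 2).aestronglyMeasurable (.of_forall fun g => ?_)
  rw [norm_pow, norm_norm, norm_mul, RCLike.norm_conj, mul_pow, Pi.add_apply]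
  nlinarith [sq_nonneg (‖g i‖ ^ 2 - ‖g j‖ ^ 2), sq_nonneg (‖g i‖ ^ 2), sq_nonneg (‖g j‖ ^ 2)]

/-- The distance of the normalized Gram matrix of an `n × k` matrix from the identity. -/
noncomputable def gramDefect {n : ℕ} (G : Fin n → Fin k → ℂ) : ℝ :=
  ‖((2 * n : ℂ)⁻¹ • ((Matrix.of G)ᴴ * Matrix.of G)) - 1‖

lemma gramDefect_nonneg {n : ℕ} (G : Fin n → Fin k → ℂ) : 0 ≤ gramDefect G := norm_nonneg _

/-- Each summand is the squared deviation of an average over the `n` rows from its mean; `- 0`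
records the zero mean of the imaginary parts, so that both kinds have the same form. -/
lemma gramDefect_sq {n : ℕ} (G : Fin n → Fin k → ℂ) :
    gramDefect G ^ 2 = ∑ i, ∑ j,
      (((∑ l, ((1 / 2 : ℝ) * (starRingEnd ℂ (G l i) * G l j).re)) / n - if i = j then 1 else 0) ^ 2
      + ((∑ l, ((1 / 2 : ℝ) * (starRingEnd ℂ (G l i) * G l j).im)) / n - 0) ^ 2) := by
  rw [gramDefect, Matrix.frobenius_norm_sq]
  refine Finset.sum_congr rfl fun i _ => Finset.sum_congr rfl fun j _ => ?_
  have h : ((2 * n : ℂ)⁻¹ • ((Matrix.of G)ᴴ * Matrix.of G) - 1 : Matrix (Fin k) (Fin k) ℂ) i j =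
      (((2 * n : ℝ)⁻¹ : ℝ) : ℂ) * (∑ l, starRingEnd ℂ (G l i) * G l j) -
        (((if i = j then 1 else 0) : ℝ) : ℂ) := by
    by_cases hij : i = j <;> simp [Matrix.mul_apply, hij]
  rw [h, Complex.sq_norm, Complex.normSq_apply, Complex.sub_re, Complex.sub_im,
    Complex.re_ofReal_mul, Complex.im_ofReal_mul, Complex.ofReal_re, Complex.ofReal_im,
    Complex.re_sum, Complex.im_sum, ← Finset.mul_sum, ← Finset.mul_sum, mul_inv]
  ring

lemma continuous_gramDefect {n : ℕ} : Continuous (gramDefect (k := k) (n := n)) := by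
  have h : gramDefect (k := k) (n := n) = fun G => √(gramDefect G ^ 2) := by
    ext G
    rw [Real.sqrt_sq (gramDefect_nonneg G)]
  rw [h]
  simp only [gramDefect_sq, Complex.mul_re, Complex.mul_im, Complex.conj_re, Complex.conj_im]
  fun_prop

lemma exists_integral_gramDefect_sq_le (k : ℕ) :
    ∃ c : ℝ, 0 ≤ c ∧ ∀ n : ℕ, n ≠ 0 →
      Integrable (fun G => gramDefect G ^ 2) (gaussianMatrix n k) ∧
        ∫ G, gramDefect G ^ 2 ∂gaussianMatrix n k ≤ c / n := by
  let R (i j : Fin k) (g : Fin k → ℂ) : ℝ := 1 / 2 * (starRingEnd ℂ (g i) * g j).re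
  let I (i j : Fin k) (g : Fin k → ℂ) : ℝ := 1 / 2 * (starRingEnd ℂ (g i) * g j).im
  have hR (i j : Fin k) : MemLp (R i j) 2 (gaussianVector k) :=
    (memLp_conj_mul_gaussianVector i j).re.const_mul _
  have hI (i j : Fin k) : MemLp (I i j) 2 (gaussianVector k) :=
    (memLp_conj_mul_gaussianVector i j).im.const_mul _
  have hint (i j : Fin k) : Integrable (fun g => starRingEnd ℂ (g i) * g j) (gaussianVector k) :=
    (memLp_conj_mul_gaussianVector i j).integrable one_le_two
  have hRm (i j : Fin k) : ∫ g, R i j g ∂gaussianVector k = if i = j then 1 else 0 := by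
    have h := integral_re (hint i j)
    rw [integral_conj_mul_gaussianVector] at h
    simp only [R, integral_const_mul]
    refine (congrArg (1 / 2 * ·) h).trans ?_
    split_ifs <;> norm_num
  have hIm (i j : Fin k) : ∫ g, I i j g ∂gaussianVector k = 0 := by
    have h := integral_im (hint i j)
    rw [integral_conj_mul_gaussianVector] at h
    simp only [I, integral_const_mul]
    refine (congrArg (1 / 2 * ·) h).trans ?_
    split_ifs <;> norm_num
  -- The constant sums variances for a single row, hence does not depend on `n`.
  refine ⟨∑ i, ∑ j, (Var[R i j; gaussianVector k] + Var[I i j; gaussianVector k]),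
    Finset.sum_nonneg fun i _ => Finset.sum_nonneg fun j _ =>
      add_nonneg (variance_nonneg _ _) (variance_nonneg _ _), fun n hn => ?_⟩
  have hav {X : (Fin k → ℂ) → ℝ} (hX : MemLp X 2 (gaussianVector k)) (m : ℝ) :
      Integrable (fun G : Fin n → Fin k → ℂ => ((∑ l, X (G l)) / n - m) ^ 2)
        (gaussianMatrix n k) := by
    have hsum : MemLp (fun G : Fin n → Fin k → ℂ => ∑ l, X (G l)) 2 (gaussianMatrix n k) :=
      memLp_finsetSum _ fun l _ => hX.comp_measurePreserving (measurePreserving_eval _ l)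
    have := ((hsum.mul_const (n : ℝ)⁻¹).sub (memLp_const m)).integrable_sq
    simpa [div_eq_mul_inv] using this
  have hterm (i j : Fin k) : Integrable (fun G : Fin n → Fin k → ℂ =>
      ((∑ l, R i j (G l)) / n - if i = j then 1 else 0) ^ 2 + ((∑ l, I i j (G l)) / n - 0) ^ 2)
      (gaussianMatrix n k) := (hav (hR i j) (if i = j then 1 else 0)).add (hav (hI i j) 0)
  have hsq (G : Fin n → Fin k → ℂ) : gramDefect G ^ 2 = ∑ i, ∑ j,
      (((∑ l, R i j (G l)) / n - if i = j then 1 else 0) ^ 2 +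
        ((∑ l, I i j (G l)) / n - 0) ^ 2) := gramDefect_sq G
  simp only [hsq]
  refine ⟨integrable_finsetSum _ fun i _ => integrable_finsetSum _ fun j _ => hterm i j, ?_⟩
  rw [integral_finsetSum _ fun i _ => integrable_finsetSum _ fun j _ => hterm i j, Finset.sum_div]
  refine Finset.sum_le_sum fun i _ => ?_
  rw [integral_finsetSum _ fun j _ => hterm i j, Finset.sum_div]
  refine Finset.sum_le_sum fun j _ => le_of_eq ?_
  rw [integral_add (hav (hR i j) _) (hav (hI i j) 0), add_div,
    ← integral_sq_average_sub (hR i j) hn, ← integral_sq_average_sub (hI i j) hn, hRm, hIm]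
  rfl

end GramConcentration

/-! ### Comparison of the Haar and Gaussian averages -/

section Comparison

open scoped Matrix
open ProbabilityTheory

variable {n k : ℕ}

/-- The phase at a pair of normalized complex matrices. -/
noncomputable def scaledPhase (l : Fin n → ℝ) (η : Matrix (Fin k) (Fin k) ℂ)
    (G H : Fin n → Fin k → ℂ) : ℂ :=
  phase l η ((((√(2 * n))⁻¹ : ℝ) : ℂ) • Matrix.of G) ((((√(2 * n))⁻¹ : ℝ) : ℂ) • Matrix.of H)

lemma continuous_scaledPhase (l : Fin n → ℝ) (η : Matrix (Fin k) (Fin k) ℂ) {T : Type*}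
    [TopologicalSpace T] {G H : T → Fin n → Fin k → ℂ} (hG : Continuous G) (hH : Continuous H) :
    Continuous fun t => scaledPhase l η (G t) (H t) :=
  by
  refine continuous_phase l η ?_ ?_
  · exact continuous_const.smul (f := fun _ => (((√(2 * n))⁻¹ : ℝ) : ℂ))
      (g := fun t => (Matrix.of (G t) : Matrix (Fin n) (Fin k) ℂ)) hG
  · exact continuous_const.smul (f := fun _ => (((√(2 * n))⁻¹ : ℝ) : ℂ))
      (g := fun t => (Matrix.of (H t) : Matrix (Fin n) (Fin k) ℂ)) hH

lemma norm_scaledPhase (l : Fin n → ℝ) (η : Matrix (Fin k) (Fin k) ℂ)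
    (G H : Fin n → Fin k → ℂ) : ‖scaledPhase l η G H‖ = 1 :=
  norm_phase _ _ _ _

lemma continuous_leftMulCLM_transpose :
    Continuous fun p : Matrix.unitaryGroup (Fin n) ℂ × (Fin n → Fin k → ℂ) =>
      leftMulCLM k (p.1 : Matrix (Fin n) (Fin n) ℂ)ᵀ p.2 :=
  ((continuous_subtype_val.comp continuous_fst).matrix_transpose).matrix_mul
    (B := fun p : Matrix.unitaryGroup (Fin n) ℂ × (Fin n → Fin k → ℂ) => Matrix.of p.2)
    continuous_snd

open scoped Matrix.Norms.Frobenius in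
lemma gramDefect_eq (hn : n ≠ 0) (G : Fin n → Fin k → ℂ) :
    gramDefect G = ‖((((√(2 * n))⁻¹ : ℝ) : ℂ) • Matrix.of G)ᴴ *
      ((((√(2 * n))⁻¹ : ℝ) : ℂ) • Matrix.of G) - 1‖ := by
  have h : ((((√(2 * n))⁻¹ : ℝ) : ℂ)) * (((√(2 * n))⁻¹ : ℝ) : ℂ) = (2 * n : ℂ)⁻¹ := by
    rw [← Complex.ofReal_mul, ← mul_inv, Real.mul_self_sqrt (by positivity)]
    push_cast
    rfl
  rw [gramDefect, Matrix.conjTranspose_smul, Matrix.smul_mul, Matrix.mul_smul, smul_smul,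
    RCLike.star_def, Complex.conj_ofReal, h]

/-- Rotating by the transpose `Aᵀ` makes the unitary polar factor act on `A` by left translation,
which Haar measure ignores. -/
lemma smul_leftMulCLM_transpose_eq (h : k ≤ n) (c : ℂ) {A B : Matrix (Fin n) (Fin n) ℂ}
    {F : Fin n → Fin k → ℂ} {P : Matrix (Fin k) (Fin k) ℂ}
    (hF : c • Matrix.of F = B.submatrix id (Fin.castLEEmb h) * P) :
    c • Matrix.of (leftMulCLM k Aᵀ F) = topRows h (Bᵀ * A) * P := by
  have h1 : c • Matrix.of (leftMulCLM k Aᵀ F) = Aᵀ * (c • Matrix.of F) := by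
    rw [Matrix.mul_smul]
    rfl
  rw [h1, hF, ← Matrix.mul_assoc]
  congr 1
  rw [topRows, Matrix.transpose_mul, Matrix.transpose_transpose]
  ext i j
  simp [Matrix.mul_apply]

/-- The phase at a pair of matrices rotated by a pair of unitary matrices. -/
noncomputable def rotatedPhase (l : Fin n → ℝ) (η : Matrix (Fin k) (Fin k) ℂ)
    (q : (Fin n → Fin k → ℂ) × (Fin n → Fin k → ℂ))
    (p : Matrix.unitaryGroup (Fin n) ℂ × Matrix.unitaryGroup (Fin n) ℂ) : ℂ :=
  scaledPhase l η (leftMulCLM k (p.1 : Matrix (Fin n) (Fin n) ℂ)ᵀ q.1)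
    (leftMulCLM k (p.2 : Matrix (Fin n) (Fin n) ℂ)ᵀ q.2)

lemma norm_rotatedPhase (l : Fin n → ℝ) (η : Matrix (Fin k) (Fin k) ℂ)
    (q : (Fin n → Fin k → ℂ) × (Fin n → Fin k → ℂ))
    (p : Matrix.unitaryGroup (Fin n) ℂ × Matrix.unitaryGroup (Fin n) ℂ) :
    ‖rotatedPhase l η q p‖ = 1 :=
  norm_scaledPhase _ _ _ _

lemma integrable_rotatedPhase (l : Fin n → ℝ) (η : Matrix (Fin k) (Fin k) ℂ) :
    Integrable (Function.uncurry (rotatedPhase l η))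
      (((gaussianMatrix n k).prod (gaussianMatrix n k)).prod
        ((unitaryHaar n).prod (unitaryHaar n))) := by
  have h1 : Continuous fun r : ((Fin n → Fin k → ℂ) × (Fin n → Fin k → ℂ)) ×
      (Matrix.unitaryGroup (Fin n) ℂ × Matrix.unitaryGroup (Fin n) ℂ) =>
        leftMulCLM k (r.2.1 : Matrix (Fin n) (Fin n) ℂ)ᵀ r.1.1 :=
    continuous_leftMulCLM_transpose.comp (f := fun r : ((Fin n → Fin k → ℂ) ×
      (Fin n → Fin k → ℂ)) × (Matrix.unitaryGroup (Fin n) ℂ × Matrix.unitaryGroup (Fin n) ℂ) =>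
        (r.2.1, r.1.1)) (by fun_prop)
  have h2 : Continuous fun r : ((Fin n → Fin k → ℂ) × (Fin n → Fin k → ℂ)) ×
      (Matrix.unitaryGroup (Fin n) ℂ × Matrix.unitaryGroup (Fin n) ℂ) =>
        leftMulCLM k (r.2.2 : Matrix (Fin n) (Fin n) ℂ)ᵀ r.1.2 :=
    continuous_leftMulCLM_transpose.comp (f := fun r : ((Fin n → Fin k → ℂ) ×
      (Fin n → Fin k → ℂ)) × (Matrix.unitaryGroup (Fin n) ℂ × Matrix.unitaryGroup (Fin n) ℂ) =>
        (r.2.2, r.1.2)) (by fun_prop)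
  have hcont : Continuous (Function.uncurry (rotatedPhase l η)) :=
    continuous_scaledPhase l η h1 h2
  exact Integrable.of_bound hcont.aestronglyMeasurable 1
    (.of_forall fun r => (norm_rotatedPhase l η r.1 r.2).le)

/-- Left invariance removes `W` and `V`; cyclicity of the trace moves `S` and `T` into the
parameter. -/
lemma integral_rotatedPhase_eq (h : k ≤ n) (l : Fin n → ℝ)
    (η S T : Matrix (Fin k) (Fin k) ℂ) (q : (Fin n → Fin k → ℂ) × (Fin n → Fin k → ℂ))
    {W V : Matrix (Fin n) (Fin n) ℂ} (hW : W ∈ Matrix.unitaryGroup (Fin n) ℂ)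
    (hV : V ∈ Matrix.unitaryGroup (Fin n) ℂ)
    (hGW : (((√(2 * n))⁻¹ : ℝ) : ℂ) • Matrix.of q.1 = W.submatrix id (Fin.castLEEmb h) * S)
    (hHV : (((√(2 * n))⁻¹ : ℝ) : ℂ) • Matrix.of q.2 = V.submatrix id (Fin.castLEEmb h) * T) :
    ∫ p, rotatedPhase l η q p ∂((unitaryHaar n).prod (unitaryHaar n)) =
      unitaryPhase h l (S * η * Tᴴ) := by
  let g : Matrix.unitaryGroup (Fin n) ℂ × Matrix.unitaryGroup (Fin n) ℂ :=
    (⟨Wᵀ, Matrix.transpose_mem_unitaryGroup_iff.mpr hW⟩,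
      ⟨Vᵀ, Matrix.transpose_mem_unitaryGroup_iff.mpr hV⟩)
  let f (p : Matrix.unitaryGroup (Fin n) ℂ × Matrix.unitaryGroup (Fin n) ℂ) : ℂ :=
    phase l (S * η * Tᴴ) (topRows h p.1) (topRows h p.2)
  have hpt (p : Matrix.unitaryGroup (Fin n) ℂ × Matrix.unitaryGroup (Fin n) ℂ) :
      rotatedPhase l η q p = f (g * p) := by
    rw [rotatedPhase, scaledPhase, smul_leftMulCLM_transpose_eq h _ hGW,
      smul_leftMulCLM_transpose_eq h _ hHV, phase, trace_mul_weightedGram_mul]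
    rfl
  simp only [hpt]
  exact integral_mul_left_eq_self f g

open scoped Matrix.Norms.Frobenius in
/-- For matrices with almost orthonormal columns, averaging the phase over the unitary group gives
the spherical function at a small perturbation of the parameter. -/
lemma norm_integral_rotatedPhase_sub_le (h : k ≤ n) (hn : n ≠ 0) (l : Fin n → ℝ)
    (η : Matrix (Fin k) (Fin k) ℂ) (q : (Fin n → Fin k → ℂ) × (Fin n → Fin k → ℂ)) :
    ‖(∫ p, rotatedPhase l η q p ∂((unitaryHaar n).prod (unitaryHaar n))) -
        unitaryPhase h l η‖ ≤
      (‖η‖ * (1 + k ^ 2 * ∑ i, (l i / n) ^ 2) + 2) *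
        (gramDefect q.1 * gramDefect q.2 + gramDefect q.1 + gramDefect q.2) := by
  have hG0 := gramDefect_nonneg q.1
  have hH0 := gramDefect_nonneg q.2
  have hGH : 0 ≤ gramDefect q.1 * gramDefect q.2 := mul_nonneg hG0 hH0
  have hM : 0 ≤ 1 + k ^ 2 * ∑ i, (l i / n) ^ 2 := by positivity
  have hD : 0 ≤ ‖η‖ * (1 + k ^ 2 * ∑ i, (l i / n) ^ 2) := mul_nonneg (norm_nonneg _) hM
  by_cases hsmall : gramDefect q.1 < 1 ∧ gramDefect q.2 < 1
  · obtain ⟨hG, hH⟩ := hsmall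
    rw [gramDefect_eq hn] at hG hH
    obtain ⟨S, -, hS1, W, hW, hGW⟩ := Matrix.exists_polar (Fin.castLEEmb h) _ hG
    obtain ⟨T, hT, hT1, V, hV, hHV⟩ := Matrix.exists_polar (Fin.castLEEmb h) _ hH
    rw [integral_rotatedPhase_eq h l η S T q hW hV hGW hHV, hT]
    refine (norm_unitaryPhase_sub_le h l _ _).trans ?_
    have hpert := Matrix.norm_mul_mul_sub_le S T η (hS1.trans_eq (gramDefect_eq hn q.1).symm)
      (hT1.trans_eq (gramDefect_eq hn q.2).symm)
    refine (mul_le_mul_of_nonneg_right hpert hM).trans ?_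
    rw [mul_right_comm]
    exact mul_le_mul_of_nonneg_right (by linarith) (by linarith)
  -- Polar decomposition may fail here, but the left side is at most 2 and some defect is at least
  -- 1; the summand 2 in the constant covers this case.
  · have hbig : 1 ≤ gramDefect q.1 * gramDefect q.2 + gramDefect q.1 + gramDefect q.2 := by
      by_contra hlt
      exact hsmall ⟨by linarith, by linarith⟩
    have h1 : ‖∫ p, rotatedPhase l η q p ∂((unitaryHaar n).prod (unitaryHaar n))‖ ≤ 1 := by
      refine (norm_integral_le_of_norm_le (integrable_const 1)
        (.of_forall fun p => (norm_rotatedPhase _ _ _ _).le)).trans ?_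
      simp
    have h2 := norm_unitaryPhase_le h l η
    refine (norm_sub_le _ _).trans ?_
    have h3 := mul_le_mul_of_nonneg_left hbig
      (show 0 ≤ ‖η‖ * (1 + k ^ 2 * ∑ i, (l i / n) ^ 2) + 2 by linarith)
    linarith

/-- The average of `scaledPhase` over pairs of independent Gaussian matrices. -/
noncomputable def gaussianPhase (l : Fin n → ℝ) (η : Matrix (Fin k) (Fin k) ℂ) : ℂ :=
  ∫ q, scaledPhase l η q.1 q.2 ∂((gaussianMatrix n k).prod (gaussianMatrix n k))

lemma integral_rotatedPhase_gaussianMatrix (l : Fin n → ℝ) (η : Matrix (Fin k) (Fin k) ℂ)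
    (p : Matrix.unitaryGroup (Fin n) ℂ × Matrix.unitaryGroup (Fin n) ℂ) :
    ∫ q, rotatedPhase l η q p ∂((gaussianMatrix n k).prod (gaussianMatrix n k)) =
      gaussianPhase l η := by
  have hmp := (measurePreserving_leftMulCLM (k := k)
    (Matrix.transpose_mem_unitaryGroup_iff.mpr p.1.2)).prod
      (measurePreserving_leftMulCLM (k := k) (Matrix.transpose_mem_unitaryGroup_iff.mpr p.2.2))
  have hmap := integral_map (μ := (gaussianMatrix n k).prod (gaussianMatrix n k))
    hmp.measurable.aemeasurable
    (f := fun q : (Fin n → Fin k → ℂ) × (Fin n → Fin k → ℂ) => scaledPhase l η q.1 q.2)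
    (continuous_scaledPhase l η continuous_fst continuous_snd).aestronglyMeasurable
  rw [hmp.map_eq] at hmap
  exact hmap.symm

/-- For every fixed pair of rotations the Gaussian integral is the same by invariance; averaging
over the pair and applying Fubini brings the Haar integral inside. -/
lemma gaussianPhase_eq_integral_unitary (l : Fin n → ℝ) (η : Matrix (Fin k) (Fin k) ℂ) :
    gaussianPhase l η = ∫ q, ∫ p, rotatedPhase l η q p
      ∂((unitaryHaar n).prod (unitaryHaar n))
        ∂((gaussianMatrix n k).prod (gaussianMatrix n k)) := by
  rw [integral_integral_swap (integrable_rotatedPhase l η)]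
  simp only [integral_rotatedPhase_gaussianMatrix, integral_const, probReal_univ, one_smul]

lemma gaussianPhase_diagonal (hn : n ≠ 0) (l : Fin n → ℝ) (ξ : Fin k → ℝ) :
    gaussianPhase l (Matrix.diagonal fun j => (ξ j : ℂ)) =
      ((∏ j, modifiedPolya (polyaT n l) (ξ j) : ℝ) : ℂ) := by
  have hn' : (n : ℝ) ≠ 0 := by positivity
  -- The 1/(2n) is the product of the two scalings 1/√(2n); the squared coefficient ξ_j² (l_i/n)² /
  -- 4 produces the 1/4 in Π.
  have h := integral_exp_gaussianMatrix_prod fun (i : Fin n) (j : Fin k) => ξ j * l i / (2 * n)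
  rw [gaussianPhase]
  refine Eq.trans (integral_congr_ae (.of_forall fun q => ?_)) (h.trans ?_)
  · dsimp only [scaledPhase, phase]
    congr 3
    simp only [Matrix.trace, Matrix.diag, Matrix.diagonal_mul, weightedGram_apply,
      Matrix.smul_apply, Matrix.of_apply, smul_eq_mul, map_mul, Complex.conj_ofReal,
      Finset.mul_sum, Complex.re_sum]
    rw [Finset.sum_comm]
    refine Finset.sum_congr rfl fun i _ => Finset.sum_congr rfl fun j _ => ?_
    have hs : (√(2 * n))⁻¹ * (√(2 * n))⁻¹ = 1 / (2 * n : ℝ) := by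
      rw [← mul_inv, Real.mul_self_sqrt (by positivity), one_div]
    have h2 : (ξ j : ℂ) * ((((√(2 * n))⁻¹ : ℝ) : ℂ) * starRingEnd ℂ (q.2 i j) * l i *
        ((((√(2 * n))⁻¹ : ℝ) : ℂ) * q.1 i j)) =
        ((ξ j * l i * ((√(2 * n))⁻¹ * (√(2 * n))⁻¹) : ℝ) : ℂ) *
          (q.1 i j * starRingEnd ℂ (q.2 i j)) := by
      push_cast
      ring
    rw [h2, Complex.re_ofReal_mul, hs]
    ring
  · congr 1
    rw [Finset.prod_comm]
    refine Finset.prod_congr rfl fun j _ => ?_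
    rw [modifiedPolya_polyaT]
    refine Finset.prod_congr rfl fun i _ => ?_
    congr 2
    field_simp
    ring

open scoped Matrix.Norms.Frobenius in
lemma exists_norm_gaussianPhase_sub_unitaryPhase_le (k : ℕ) :
    ∃ c : ℝ, ∀ (n : ℕ) (h : k ≤ n) (_ : n ≠ 0) (l : Fin n → ℝ)
      (η : Matrix (Fin k) (Fin k) ℂ),
      ‖gaussianPhase l η - unitaryPhase h l η‖ ≤
        (‖η‖ * (1 + k ^ 2 * ∑ i, (l i / n) ^ 2) + 2) *
          ((c * (√n)⁻¹) ^ 2 + 2 * (c * (√n)⁻¹)) := by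
  obtain ⟨c, hc, hbound⟩ := exists_integral_gramDefect_sq_le k
  refine ⟨(1 + c) / 2, fun n h hn l η => ?_⟩
  obtain ⟨hint, hle⟩ := hbound n hn
  have hn' : 0 < (n : ℝ) := by positivity
  have hs : 0 < √(n : ℝ) := Real.sqrt_pos.mpr hn'
  have hint1 : Integrable (gramDefect (n := n) (k := k)) (gaussianMatrix n k) :=
    ((memLp_two_iff_integrable_sq continuous_gramDefect.aestronglyMeasurable).mpr
      hint).integrable one_le_two
  have hmean0 : 0 ≤ ∫ G, gramDefect G ∂gaussianMatrix n k :=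
    integral_nonneg fun G => gramDefect_nonneg G
  have hmean : ∫ G, gramDefect G ∂gaussianMatrix n k ≤ (1 + c) / 2 * (√n)⁻¹ := by
    -- AM–GM weighted by √n: with second moment at most c/n it bounds the mean by (1 + c)/(2√n).
    have hpt (G : Fin n → Fin k → ℂ) :
        gramDefect G ≤ (√(n : ℝ))⁻¹ / 2 + √n / 2 * gramDefect G ^ 2 := by
      have h1 : (√(n : ℝ))⁻¹ / 2 + √n / 2 * gramDefect G ^ 2 - gramDefect G =
          (√(n : ℝ))⁻¹ / 2 * (√n * gramDefect G - 1) ^ 2 := by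
        field_simp
        ring
      have h2 : 0 ≤ (√(n : ℝ))⁻¹ / 2 * (√n * gramDefect G - 1) ^ 2 := by positivity
      linarith
    refine (integral_mono hint1 ((integrable_const _).add (hint.const_mul _)) hpt).trans ?_
    simp only [Pi.add_apply]
    rw [integral_add (integrable_const _) (hint.const_mul _), integral_const_mul, integral_const,
      probReal_univ, one_smul]
    have h1 := mul_le_mul_of_nonneg_left hle (show 0 ≤ √(n : ℝ) / 2 by positivity)
    have h2 : √(n : ℝ) / 2 * (c / n) = c / 2 * (√n)⁻¹ := by
      have := Real.mul_self_sqrt hn'.le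
      field_simp
      rw [sq, this]
      ring
    linarith
  have hprod : Integrable (fun q : (Fin n → Fin k → ℂ) × (Fin n → Fin k → ℂ) =>
      gramDefect q.1 * gramDefect q.2) ((gaussianMatrix n k).prod (gaussianMatrix n k)) :=
    hint1.mul_prod hint1
  have hfst := hint1.comp_fst (gaussianMatrix n k)
  have hsnd := hint1.comp_snd (gaussianMatrix n k)
  rw [gaussianPhase_eq_integral_unitary]
  have hint2 : Integrable (fun q => ∫ p, rotatedPhase l η q p
      ∂((unitaryHaar n).prod (unitaryHaar n)))
      ((gaussianMatrix n k).prod (gaussianMatrix n k)) :=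
    (integrable_rotatedPhase l η).integral_prod_left
  have hconst : unitaryPhase h l η = ∫ _ : (Fin n → Fin k → ℂ) × (Fin n → Fin k → ℂ),
      unitaryPhase h l η ∂((gaussianMatrix n k).prod (gaussianMatrix n k)) := by simp
  rw [hconst, ← integral_sub hint2 (integrable_const _)]
  refine (norm_integral_le_of_norm_le (((hprod.add hfst).add hsnd).const_mul
    (‖η‖ * (1 + k ^ 2 * ∑ i, (l i / n) ^ 2) + 2))
    (.of_forall fun q => norm_integral_rotatedPhase_sub_le h hn l η q)).trans ?_
  rw [integral_const_mul]
  have hM : 0 ≤ ∑ i, (l i / n) ^ 2 := Finset.sum_nonneg fun i _ => sq_nonneg _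
  refine mul_le_mul_of_nonneg_left ?_ (by positivity)
  -- Independence of the two matrices factors the mean of the product of defects.
  rw [integral_add' (hprod.add hfst) hsnd, integral_add' hprod hfst,
    integral_prod_mul (fun G => gramDefect G) (fun G => gramDefect G),
    integral_fun_fst, integral_fun_snd, probReal_univ, one_smul]
  nlinarith

end Comparison

/-! ### Passage to the limit -/

section Limit

open scoped Matrix.Norms.Frobenius in
lemma exists_norm_sphericalFn_sub_prod_modifiedPolya_le (k : ℕ) :
    ∃ c : ℝ, ∀ n : ℕ, k ≤ n → n ≠ 0 → ∀ (l : Fin n → ℝ) (ξ : Fin k → ℝ),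
      ‖sphericalFn n (infDiag ξ) l - ((∏ j, modifiedPolya (polyaT n l) (ξ j) : ℝ) : ℂ)‖ ≤
        (√(∑ j, ξ j ^ 2) * (1 + k ^ 2 * polyaL (ContinuousMap.const ℝ 1) (polyaT n l)) + 2) *
          ((c * (√n)⁻¹) ^ 2 + 2 * (c * (√n)⁻¹)) := by
  obtain ⟨c, hc⟩ := exists_norm_gaussianPhase_sub_unitaryPhase_le k
  refine ⟨c, fun n h hn l ξ => ?_⟩
  have hnorm : ‖Matrix.diagonal fun j => (ξ j : ℂ)‖ = √(∑ j, ξ j ^ 2) := by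
    rw [Matrix.frobenius_norm_diagonal, EuclideanSpace.norm_eq]
    simp
  rw [sphericalFn_infDiag h, ← gaussianPhase_diagonal hn, norm_sub_rev, ← hnorm,
    polyaL_one_polyaT]
  exact hc n h hn l _

/-- Convergence is taken jointly in `n` and the argument, which is what local uniformity needs. The
error bound vanishes because the masses `L_1` of T_n(l) converge. -/
lemma tendsto_sphericalFn (l : (n : ℕ) → Fin n → ℝ) {ω : PolyaSpace}
    (hl : Tendsto (fun n : ℕ => polyaT n (l n)) atTop (𝓝 ω)) {k : ℕ} (ξ₀ : Fin k → ℝ) :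
    Tendsto (fun p : ℕ × (Fin k → ℝ) => sphericalFn p.1 (infDiag p.2) (l p.1))
      (atTop ×ˢ 𝓝 ξ₀) (𝓝 ((∏ j, modifiedPolya ω (ξ₀ j) : ℝ) : ℂ)) := by
  obtain ⟨c, hc⟩ := exists_norm_sphericalFn_sub_prod_modifiedPolya_le k
  have hω : Tendsto (fun p : ℕ × (Fin k → ℝ) => polyaT p.1 (l p.1)) (atTop ×ˢ 𝓝 ξ₀) (𝓝 ω) :=
    hl.comp tendsto_fst
  have hξ : Tendsto (fun p : ℕ × (Fin k → ℝ) => p.2) (atTop ×ˢ 𝓝 ξ₀) (𝓝 ξ₀) := tendsto_snd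
  have hn : Tendsto (fun p : ℕ × (Fin k → ℝ) => c * (√(p.1 : ℝ))⁻¹) (atTop ×ˢ 𝓝 ξ₀) (𝓝 0) := by
    have h : Tendsto (fun n : ℕ => c * (√(n : ℝ))⁻¹) atTop (𝓝 (c * 0)) :=
      ((tendsto_inv_atTop_zero.comp Real.tendsto_sqrt_atTop).comp
        tendsto_natCast_atTop_atTop).const_mul c
    rw [mul_zero] at h
    exact h.comp tendsto_fst
  have hmain : Tendsto (fun p : ℕ × (Fin k → ℝ) =>
      ((∏ j, modifiedPolya (polyaT p.1 (l p.1)) (p.2 j) : ℝ) : ℂ))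
      (atTop ×ˢ 𝓝 ξ₀) (𝓝 ((∏ j, modifiedPolya ω (ξ₀ j) : ℝ) : ℂ)) := by
    refine (Complex.continuous_ofReal.tendsto _).comp (tendsto_finsetProd _ fun j _ => ?_)
    exact (continuous_modifiedPolya.tendsto (ω, ξ₀ j)).comp
      (hω.prodMk_nhds (((continuous_apply j).tendsto ξ₀).comp hξ))
  have hnorm : Tendsto (fun p : ℕ × (Fin k → ℝ) => √(∑ j, p.2 j ^ 2)) (atTop ×ˢ 𝓝 ξ₀)
      (𝓝 (√(∑ j, ξ₀ j ^ 2))) :=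
    ((show Continuous fun ξ : Fin k → ℝ => √(∑ j, ξ j ^ 2) by fun_prop).tendsto ξ₀).comp hξ
  have hmass := ((continuous_polyaL (ContinuousMap.const ℝ 1)).tendsto ω).comp hω
  have hbound := ((hnorm.mul ((hmass.const_mul ((k : ℝ) ^ 2)).const_add 1)).add_const 2).mul
    ((hn.pow 2).add (hn.const_mul 2))
  have hdiff : Tendsto (fun p : ℕ × (Fin k → ℝ) => sphericalFn p.1 (infDiag p.2) (l p.1) -
      ((∏ j, modifiedPolya (polyaT p.1 (l p.1)) (p.2 j) : ℝ) : ℂ)) (atTop ×ˢ 𝓝 ξ₀) (𝓝 0) := by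
    refine squeeze_zero_norm' ?_ (by simpa using hbound)
    -- `k + 1` secures both `k ≤ n` and `n ≠ 0`, also when `k = 0`.
    filter_upwards [tendsto_fst.eventually (eventually_ge_atTop (k + 1))] with p hp
    exact hc p.1 (by omega) (by omega) (l p.1) p.2
  simpa using hdiff.add hmain

lemma continuous_prod_modifiedPolya (ω : PolyaSpace) (k : ℕ) :
    Continuous fun ξ : Fin k → ℝ => ((∏ j, modifiedPolya ω (ξ j) : ℝ) : ℂ) := by
  have h : Continuous fun t : ℝ => modifiedPolya ω t :=
    continuous_modifiedPolya.comp (f := fun t : ℝ => (ω, t)) (by fun_prop)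
  exact Complex.continuous_ofReal.comp
    (continuous_finsetProd _ fun j _ => h.comp (continuous_apply j))

end Limit

theorem theorem4p5 (l : (n : ℕ) → Fin n → ℝ) (ω : PolyaSpace)
    (hl : Tendsto (fun n : ℕ => polyaT n (l n)) atTop (𝓝 ω))
    (k : ℕ) (K : Set (Fin k → ℝ)) (hK : IsCompact K) :
    TendstoUniformlyOn
      (fun (n : ℕ) (ξ : Fin k → ℝ) => sphericalFn n (infDiag ξ) (l n))
      (fun ξ : Fin k → ℝ => ((∏ j : Fin k, modifiedPolya ω (ξ j) : ℝ) : ℂ))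
      atTop K := by
  -- On a compact set local uniformity suffices; at each point it follows once the function and its
  -- continuous limit converge jointly to the same value.
  rw [← tendstoLocallyUniformlyOn_iff_tendstoUniformlyOn_of_compact hK,
    tendstoLocallyUniformlyOn_iff_forall_tendsto]
  intro ξ₀ _
  have hle : (atTop : Filter ℕ) ×ˢ 𝓝[K] ξ₀ ≤ atTop ×ˢ 𝓝 ξ₀ :=
    prod_mono_right _ nhdsWithin_le_nhds
  have hlim : Tendsto (fun p : ℕ × (Fin k → ℝ) => ((∏ j, modifiedPolya ω (p.2 j) : ℝ) : ℂ))
      (atTop ×ˢ 𝓝 ξ₀) (𝓝 ((∏ j, modifiedPolya ω (ξ₀ j) : ℝ) : ℂ)) :=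
    ((continuous_prod_modifiedPolya ω k).tendsto ξ₀).comp tendsto_snd
  exact ((hlim.prodMk_nhds (tendsto_sphericalFn l hl ξ₀)).mono_left hle).mono_right
    (nhds_le_uniformity _)
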